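/- \begin{proposition} A tree is a partially ordered set with a minimum (its root) in which every initial segment $\{s : s<t\}$ is well ordered; $s\parallel t$ means that $s,t$ are comparable. Let $T$ be a tree, $S\subset T$ a subset that is a tree in the induced order, and $N\subset M$ sets with $N$ infinite. Let $K[T\times M]\subset 2^{T\times M}$ be the space of all subsets of $T\times M$ of cardinality at most $2$ whose first coordinates lie in a branch of $T$; define $K[S\times N]$ likewise, let $0$ denote the empty set, and let $g:K[T\times M]\to K[S\times N]$, $g(x)=x\cap(S\times N)$. Let $f=P(g):P(K[T\times M])\to P(K[S\times N])$ be the induced push-forward map on the spaces of Radon probability measures with the weak$^*$ topology. On $f^{-1}(\delta_0)$ put $\nu\le\nu'$ iff for every neighbourhood $U$ of $\nu$ there is a neighbourhood $U'$ of $\nu'$ with $f(U')\subset f(U)$, and let $X=\mathbb{O}_{\delta_0}(f)$ be the ordered set of classes modulo $\nu\le\nu'\le\nu$. For $t\in T$ put $r_t=\{s\in S : s\parallel t\}$, let $R=\{r_t : t\in T\}$ be ordered by reverse inclusion, and let $\hat R=\{-\infty\}\cup R\cup\{+\infty\}$, with $-\infty$ and $+\infty$ added as least and greatest elements. A point $x\in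 g^{-1}(0)$ \emph{represents} $-\infty$ if $x=\emptyset$, represents $r_t$ if $x=\{(t',\gamma)\}$ with $r_{t'}=r_t$, and represents $+\infty$ if $|x|=2$. Assume that $r_t\ne\emptyset$ for every $t\in T$ (automatic if $S$ contains the root of $T$), and that every element of $\hat R$ is represented by some point of $g^{-1}(0)$ (automatic if $M\setminus N$ has at least two elements). For $u\in\hat R$ let $a[u]\in X$ be the class of $\delta_x$ for a point $x\in g^{-1}(0)$ representing $u$. In an ordered set $O$, an immediate successor of $t$ is an $s>t$ with no element strictly between, and a linear successor of $t$ is a maximal element of the set of all $x>t$ such that $\{y : t\le y\le x\}$ is linearly ordered. A discrete (respectively, linear) walk of length $\alpha$ in $O$, for an ordinal $\alpha$, is a sequence $(a_\beta)_{\beta<\alpha}$ in $O$ such that $a_0=\min O$, $a_{\beta+1}$ is an immediate (respectively, linear) successor of $a_\beta$ whenever $\beta+1<\alpha$, and $a_\beta=\sup\{a_\gamma : \gamma<\beta\}$ for every limit ordinal $\beta<\alpha$. Then: \begin{enumerate} \item[(0)] $a[u]$ is well defined; more generally, every $\nu\in f^{-1}(\delta_0)$ for which the set of points representing $u$ has measure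 $1$ has class $a[u]$. \item[(1)] For every ordinal $\alpha$, a sequence $(a_\beta)_{\beta<\alpha}$ in $X$ is a linear walk in $X$ if and only if there is a discrete walk $(t_\beta)_{\beta<\alpha}$ in $\hat R$ with $a_\beta=a[t_\beta]$ for all $\beta<\alpha$. \item[(2)] For every $t\in\hat R$, the linear successors of $a[t]$ in $X$ are exactly the elements $a[s]$ with $s$ an immediate successor of $t$ in $\hat R$. \item[(3)] If $\beta$ is a limit ordinal, $(t_\gamma)_{\gamma<\beta}$ is an increasing sequence in $\hat R$ and $s\in\hat R$, then $s=\sup_{\gamma<\beta}t_\gamma$ if and only if $a[s]=\sup_{\gamma<\beta}a[t_\gamma]$. \end{enumerate} \end{proposition} -/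

import Mathlib

open Set Filter Topology MeasureTheory

universe u v w

noncomputable section

namespace FiberWalk

/-! ### Order-theoretic notions -/

/-- A tree: a partially ordered set with a minimum (the root) in which every initial segment
`{s | s < t}` is well ordered. -/
def IsTree (T : Type*) [PartialOrder T] : Prop :=
  (∃ r : T, IsBot r) ∧ ∀ t : T, IsWellOrder (Set.Iio t) (· < ·)

/-- `s` is a linear successor of `t`: a maximal element of the set of all `x > t` such that
`{y | t ≤ y ≤ x}` is linearly ordered. (Immediate successors are Mathlib's `t ⋖ s`.) -/
def IsLinearSucc {O : Type*} [PartialOrder O] (t s : O) : Prop :=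
  Maximal (fun x => t < x ∧ IsChain (· ≤ ·) (Set.Icc t x)) s

/-- A walk of length `α` in `O` with respect to the successor relation `Succ`. -/
def IsWalk {O : Type*} [PartialOrder O] (Succ : O → O → Prop) {α : Ordinal}
    (a : Set.Iio α → O) : Prop :=
  (∀ h : 0 < α, IsBot (a ⟨0, h⟩)) ∧
  (∀ (β : Ordinal) (h : Order.succ β < α),
    Succ (a ⟨β, (Order.le_succ β).trans_lt h⟩) (a ⟨Order.succ β, h⟩)) ∧
  (∀ (β : Set.Iio α), Order.IsSuccLimit (β : Ordinal) → IsLUB (a '' {γ | γ < β}) (a β))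

/-- Discrete walks: successor steps go to immediate successors. -/
def IsDiscreteWalk {O : Type*} [PartialOrder O] {α : Ordinal} (a : Set.Iio α → O) : Prop :=
  IsWalk (fun t s => t ⋖ s) a

/-- Linear walks: successor steps go to linear successors. -/
def IsLinearWalk {O : Type*} [PartialOrder O] {α : Ordinal} (a : Set.Iio α → O) : Prop :=
  IsWalk IsLinearSucc a

/-! ### Fiber orders -/

/-- The fiber `f⁻¹(y)`. -/
def Fiber {X Y : Type*} (f : X → Y) (y : Y) : Type _ := {x : X // f x = y}

/-- The fiber preorder: `x ≤ x'` if for every neighbourhood `U` of `x` there is a neighbourhood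
`U'` of `x'` with `f(U') ⊆ f(U)`. -/
instance fiberPreorder {X Y : Type*} [TopologicalSpace X] (f : X → Y) (y : Y) :
    Preorder (Fiber f y) where
  le x x' := ∀ U ∈ 𝓝 x.1, ∃ U' ∈ 𝓝 x'.1, f '' U' ⊆ f '' U
  le_refl _ U hU := ⟨U, hU, Subset.rfl⟩
  le_trans _ _ _ h₁ h₂ U hU :=
    let ⟨V, hV, hVU⟩ := h₁ U hU
    let ⟨W, hW, hWV⟩ := h₂ V hV
    ⟨W, hW, hWV.trans hVU⟩

/-- The fiber order `𝕆_y(f)`: the fiber preorder modulo `x ≤ x' ∧ x' ≤ x`. -/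
abbrev FiberOrder {X Y : Type*} [TopologicalSpace X] (f : X → Y) (y : Y) : Type _ :=
  Antisymmetrization (Fiber f y) (· ≤ ·)

/-! ### Spaces of Radon probability measures -/

/-- `P(K)`: the Radon (Borel, inner regular with respect to compact sets) probability measures
on `K`. -/
def RadonProb (K : Type*) [TopologicalSpace K] [MeasurableSpace K] : Type _ :=
  {μ : ProbabilityMeasure K // (μ : Measure K).InnerRegular}

/-- `P(K)` carries the weak topology (tested on bounded continuous functions). -/
instance (K : Type*) [TopologicalSpace K] [MeasurableSpace K] [BorelSpace K] :
    TopologicalSpace (RadonProb K) :=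
  inferInstanceAs (TopologicalSpace {μ : ProbabilityMeasure K // (μ : Measure K).InnerRegular})

theorem innerRegular_dirac {K : Type*} [TopologicalSpace K] [MeasurableSpace K] (x : K) :
    (Measure.dirac x).InnerRegular where
  innerRegular U hU r hr := by
    by_cases hx : x ∈ U
    · refine ⟨{x}, Set.singleton_subset_iff.2 hx, isCompact_singleton, hr.trans_le ?_⟩
      calc Measure.dirac x U ≤ 1 := prob_le_one
        _ ≤ Measure.dirac x {x} := by
          simp
    · rw [Measure.dirac_apply' _ hU] at hr
      simp [hx] at hr

/-- The Dirac measure at `x`. -/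
def RadonProb.dirac {K : Type*} [TopologicalSpace K] [MeasurableSpace K] (x : K) :
    RadonProb K :=
  ⟨⟨Measure.dirac x, inferInstance⟩, innerRegular_dirac x⟩

/-- `P(g) : P(K) → P(L)`, the push-forward of measures along a continuous map `g`. -/
def RadonProb.map {K L : Type*} [TopologicalSpace K] [MeasurableSpace K] [BorelSpace K]
    [TopologicalSpace L] [MeasurableSpace L] [BorelSpace L] (g : K → L) (hg : Continuous g)
    (μ : RadonProb K) : RadonProb L :=
  ⟨μ.1.map hg.measurable.aemeasurable, by
    have := μ.2
    exact Measure.InnerRegular.map_of_continuous hg⟩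

/-! ### The compact spaces `K[T × M]` and the map `g` -/

/-- The points of `2^{T × M}` that are subsets of cardinality at most two whose first coordinates
are contained in a branch (a maximal chain) of `T`. -/
def IsSmall {T M : Type*} [PartialOrder T] (x : T × M → Bool) : Prop :=
  {p | x p = true}.encard ≤ 2 ∧ ∃ b : Set T, IsMaxChain (· ≤ ·) b ∧ Prod.fst '' {p | x p = true} ⊆ b

/-- The space `K[T × M] ⊆ 2^{T × M}`. -/
def PairSpace (T M : Type*) [PartialOrder T] : Type _ := {x : T × M → Bool // IsSmall x}

section
variable {T M : Type*} [PartialOrder T]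

instance : TopologicalSpace (PairSpace T M) :=
  inferInstanceAs (TopologicalSpace {x : T × M → Bool // IsSmall x})

instance : MeasurableSpace (PairSpace T M) := borel _

instance : BorelSpace (PairSpace T M) := ⟨rfl⟩

/-- A point of `K[T × M]` seen as a set of pairs. -/
def PairSpace.carrier (x : PairSpace T M) : Set (T × M) := {p | x.1 p = true}

/-- The point `0` of `K[T × M]`, i.e. the empty set. -/
def PairSpace.zero (T M : Type*) [PartialOrder T] : PairSpace T M :=
  ⟨fun _ => false, by simp, by
    obtain ⟨b, hb, -⟩ := IsChain.exists_maxChain (r := ((· ≤ ·) : T → T → Prop)) IsChain.empty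
    exact ⟨b, hb, by simp⟩⟩

theorem isSmall_inter (S : Set T) (N : Set M) {x : T × M → Bool} (hx : IsSmall x) :
    IsSmall (fun p : S × N => x (p.1, p.2)) := by
  obtain ⟨hcard, b, hb, hxb⟩ := hx
  refine ⟨(encard_le_encard_of_injOn (f := fun p : S × N => ((p.1 : T), (p.2 : M)))
      (fun p hp => hp) ?_).trans hcard, ?_⟩
  · rintro ⟨a, b⟩ - ⟨c, d⟩ - h
    simpa only [Prod.mk.injEq, Subtype.ext_iff] using h
  · have hc : IsChain (· ≤ ·) (Prod.fst '' {p : S × N | x (p.1, p.2) = true}) := by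
      rintro _ ⟨p, hp, rfl⟩ _ ⟨q, hq, rfl⟩ hne
      exact hb.1 (hxb ⟨_, hp, rfl⟩) (hxb ⟨_, hq, rfl⟩) (fun h => hne (Subtype.ext h))
    exact hc.exists_maxChain

/-- The map `g : K[T × M] → K[S × N]`, `g(x) = x ∩ (S × N)`. -/
def gMap (S : Set T) (N : Set M) (x : PairSpace T M) : PairSpace S N :=
  ⟨fun p => x.1 (p.1, p.2), isSmall_inter S N x.2⟩

theorem continuous_gMap (S : Set T) (N : Set M) :
    Continuous (gMap S N : PairSpace T M → PairSpace S N) :=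
  Continuous.subtype_mk (p := IsSmall) (f := fun x : PairSpace T M => fun p : S × N =>
      x.1 ((p.1 : T), (p.2 : M)))
    (continuous_pi fun p => (continuous_apply ((p.1 : T), (p.2 : M))).comp continuous_subtype_val)
    (fun x => isSmall_inter S N x.2)

/-- The map `f = P(g) : P(K[T × M]) → P(K[S × N])`. -/
def probMap (S : Set T) (N : Set M) : RadonProb (PairSpace T M) → RadonProb (PairSpace S N) :=
  RadonProb.map (gMap S N) (continuous_gMap S N)

/-- The fiber `f⁻¹(δ₀)`. -/
abbrev FiberZero (S : Set T) (N : Set M) : Type _ :=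
  Fiber (probMap S N) (RadonProb.dirac (PairSpace.zero S N))

/-- The ordered set `X = 𝕆_{δ₀}(f)`. -/
abbrev OrderZero (S : Set T) (N : Set M) : Type _ :=
  FiberOrder (probMap S N) (RadonProb.dirac (PairSpace.zero S N))

/-! ### The ordered set `R̂` and the elements `a[t]` -/

/-- `r_t = {s ∈ S : s ∥ t}`, the set of elements of `S` comparable with `t`. -/
def trace (S : Set T) (t : T) : Set T := {s | s ∈ S ∧ (s ≤ t ∨ t ≤ s)}

/-- `R = {r_t : t ∈ T}`, ordered by reverse inclusion. -/
abbrev R (S : Set T) : Type _ := Set.range (fun t : T => OrderDual.toDual (trace S t))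

/-- `R̂ = {-∞} ∪ R ∪ {+∞}`. -/
abbrev RHat (S : Set T) : Type _ := WithBot (WithTop (R S))

/-- The element `r_t` of `R̂`. -/
def RHat.mk (S : Set T) (t : T) : RHat S :=
  (((⟨OrderDual.toDual (trace S t), t, rfl⟩ : R S) : WithTop (R S)) : RHat S)

/-- The point `x` of the fiber `g⁻¹(0)` corresponds to the element `u` of `R̂`: the empty set
corresponds to `-∞`, a singleton `{(t, γ)}` to `r_t`, and every doubleton to `+∞`. -/
def Represents (S : Set T) (N : Set M) (x : PairSpace T M) (u : RHat S) : Prop :=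
  gMap S N x = PairSpace.zero S N ∧
    ((x.carrier = ∅ ∧ u = ⊥) ∨
      (∃ (t : T) (γ : M), x.carrier = {(t, γ)} ∧ u = RHat.mk S t) ∨
      (x.carrier.encard = 2 ∧ u = ⊤))

/-- Every element of `R̂` corresponds to some point of the fiber `g⁻¹(0)`. -/
def Realized (S : Set T) (N : Set M) : Prop :=
  ∀ u : RHat S, ∃ x : PairSpace T M, Represents S N x u

theorem map_dirac (S : Set T) (N : Set M) {x : PairSpace T M}
    (hx : gMap S N x = PairSpace.zero S N) :
    probMap S N (RadonProb.dirac x) = RadonProb.dirac (PairSpace.zero S N) := by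
  apply Subtype.ext
  apply Subtype.ext
  change Measure.map (gMap S N) (Measure.dirac x) = Measure.dirac (PairSpace.zero S N)
  rw [Measure.map_dirac' (continuous_gMap S N).measurable, hx]

/-- The element `a[u]` of `𝕆_{δ₀}(f)`: the class of the unit mass at `u ∈ R̂`, that is, of the
Dirac measure at a point of `g⁻¹(0)` corresponding to `u`. -/
def unitMass (S : Set T) (N : Set M) (h : Realized S N) (u : RHat S) : OrderZero S N :=
  toAntisymmetrization (· ≤ ·)
    (⟨RadonProb.dirac (h u).choose, map_dirac S N (h u).choose_spec.1⟩ : FiberZero S N)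

end

end FiberWalk

end

/-! Every Radon probability measure on `K[T × M]` is a countable sum of point masses: a compact set
of points of one fixed cardinality is finite, and there are only three cardinalities. An element of
`f⁻¹(δ₀)` is therefore a discrete distribution on `g⁻¹(0)`, and `typ` pushes it to a discrete
distribution on `R̂`.

The type of `x` decides which `z ∈ K[S × N]` can be added to `x`: all of them for `-∞`, those with
at most one point, lying over `r`, for `r ∈ R`, only `0` for `+∞`. Higher types accept fewer `z`.
Two estimates follow. If `ν'` turns into `ν` by moving mass to lower types, the same move extends
continuously to nearby measures without changing their image, so `ν ≤ ν'` (`le_of_kernel`,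
`le_of_coupling`). Conversely, a sequence `z n → 0` that fits exactly the types in `D` shows that `ν
≤ ν'` forces the mass of `D` under `ν'` to be at most that under `ν` (`toOuterMeasure_le_of_le`),
and such sets `D` separate the points of `R̂` (`exists_separating_seq`).

Hence the class depends only on the distribution on `R̂`, and the order on classes satisfies
`IsStochasticOrder`. The rest is pure order theory. Distributions on a covering pair `t ⋖ s` form a
chain ordered by the mass at `s`. A distribution above `t` that charges anything beyond one cover of
`t` has two incomparable distributions below it and above `t`. So the linear successors of a point
mass are the point masses at covers (`isLinearSucc_iff`). Suprema of point masses are point masses,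
so walks stay among them (`isLinearWalk_iff`). -/

noncomputable section

namespace FiberWalk

/-! ### Combinatorics and topology of `K[T × M]`; unions with points of `K[S × N]` -/

section Combinatorics

variable {T M : Type*} [PartialOrder T] {S : Set T} {N : Set M}

theorem isSmall_iff {x : T × M → Bool} : IsSmall x ↔
    {p | x p = true}.encard ≤ 2 ∧ IsChain (· ≤ ·) (Prod.fst '' {p | x p = true}) :=
  and_congr_right fun _ => ⟨fun ⟨_, hb, h⟩ => hb.1.mono h, fun h => h.exists_maxChain⟩

theorem IsSmall.mono {x y : T × M → Bool} (hy : IsSmall y) (h : ∀ p, x p = true → y p = true) :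
    IsSmall x :=
  ⟨(encard_le_encard fun p hp => h p hp).trans hy.1,
    hy.2.imp fun _ hb => ⟨hb.1, (image_mono fun p hp => h p hp).trans hb.2⟩⟩

namespace PairSpace

@[ext]
theorem ext {x y : PairSpace T M} (h : ∀ p, x.1 p = y.1 p) : x = y :=
  Subtype.ext (funext h)

theorem mem_carrier {x : PairSpace T M} {p : T × M} : p ∈ x.carrier ↔ x.1 p = true := Iff.rfl

theorem ext_carrier {x y : PairSpace T M} (h : x.carrier = y.carrier) : x = y := by
  ext p
  rw [Bool.eq_iff_iff]
  exact Set.ext_iff.1 h p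

theorem encard_carrier_le (x : PairSpace T M) : x.carrier.encard ≤ 2 := x.2.1

theorem finite_carrier (x : PairSpace T M) : x.carrier.Finite :=
  finite_of_encard_le_coe (k := 2) x.encard_carrier_le

theorem isChain_carrier (x : PairSpace T M) : IsChain (· ≤ ·) (Prod.fst '' x.carrier) :=
  (isSmall_iff.1 x.2).2

@[simp]
theorem carrier_zero : (zero T M).carrier = ∅ := by
  ext p
  rw [mem_carrier]
  simp [zero]

theorem exists_carrier_eq {A : Set (T × M)} (h2 : A.encard ≤ 2)
    (hA : IsChain (· ≤ ·) (Prod.fst '' A)) : ∃ x : PairSpace T M, x.carrier = A := by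
  classical
  have h : {p | decide (p ∈ A) = true} = A := by ext p; simp
  exact ⟨⟨fun p => decide (p ∈ A), isSmall_iff.2 (by rw [h]; exact ⟨h2, hA⟩)⟩, h⟩

instance : T2Space (PairSpace T M) :=
  inferInstanceAs (T2Space {x : T × M → Bool // IsSmall x})

theorem tendsto_iff {ι : Type*} {l : Filter ι} {f : ι → PairSpace T M} {y : PairSpace T M} :
    Tendsto f l (𝓝 y) ↔ ∀ p, ∀ᶠ i in l, (f i).1 p = y.1 p := by
  refine (tendsto_subtype_rng (p := IsSmall)).trans (tendsto_pi_nhds.trans ?_)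
  simp [nhds_discrete, tendsto_pure]

theorem isClopen_setOf_apply (p : T × M) (b : Bool) :
    IsClopen {x : PairSpace T M | x.1 p = b} :=
  (isClopen_discrete {b}).preimage
    ((continuous_apply p).comp (continuous_subtype_val (p := IsSmall (T := T) (M := M))))

theorem isClopen_setOf_subset_carrier {A : Set (T × M)} (hA : A.Finite) :
    IsClopen {x : PairSpace T M | A ⊆ x.carrier} := by
  have : {x : PairSpace T M | A ⊆ x.carrier} = ⋂ p ∈ A, {x | x.1 p = true} := by
    ext x; simp [subset_def, mem_carrier]
  rw [this]
  exact hA.isClopen_biInter fun p _ => isClopen_setOf_apply p true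

open Classical in
/-- The part of `y` inside a set `A`. -/
def restr (A : Set (T × M)) (y : PairSpace T M) : PairSpace T M :=
  ⟨fun p => decide (p ∈ A) && y.1 p, y.2.mono fun p hp => by simp_all⟩

theorem restr_apply_eq_true {A : Set (T × M)} {y : PairSpace T M} {p : T × M} :
    (restr A y).1 p = true ↔ p ∈ A ∧ y.1 p = true := by
  simp [restr]

theorem restr_eq_self {A : Set (T × M)} {y : PairSpace T M} (h : y.carrier ⊆ A) :
    restr A y = y := by
  ext p
  rw [Bool.eq_iff_iff, restr_apply_eq_true]
  exact and_iff_right_of_imp fun hp => h hp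

/-- Convergence is coordinatewise, so finitely many coordinates are locally constant. This makes
`relocate` continuous for finite `A`. -/
theorem eventually_restr_eq {A : Set (T × M)} (hA : A.Finite) (y : PairSpace T M) :
    ∀ᶠ y' in 𝓝 y, restr A y' = restr A y := by
  have : ∀ᶠ y' in 𝓝 y, ∀ p ∈ A, y'.1 p = y.1 p :=
    hA.eventually_all.2 fun p _ => tendsto_iff.1 tendsto_id p
  filter_upwards [this] with y' h
  ext p
  rw [Bool.eq_iff_iff, restr_apply_eq_true, restr_apply_eq_true]
  exact and_congr_right fun hp => by rw [h p hp]

open Classical in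
/-- A point of `K[S × N]` seen as a subset of `T × M`. -/
def extend (z : PairSpace S N) (p : T × M) : Bool :=
  if h : p.1 ∈ S ∧ p.2 ∈ N then z.1 (⟨p.1, h.1⟩, ⟨p.2, h.2⟩) else false

@[simp]
theorem extend_coe (z : PairSpace S N) (q : S × N) : extend z ((q.1 : T), (q.2 : M)) = z.1 q := by
  simp [extend]

theorem extend_eq_true {z : PairSpace S N} {p : T × M} :
    extend z p = true ↔ ∃ q ∈ z.carrier, ((q.1 : T), (q.2 : M)) = p := by
  constructor
  · intro h
    unfold extend at h
    split_ifs at h with hp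
    exact ⟨_, h, rfl⟩
  · rintro ⟨q, hq, rfl⟩
    rw [extend_coe]
    exact hq

theorem extend_gMap {y : PairSpace T M} {p : T × M} (h : extend (gMap S N y) p = true) :
    y.1 p = true := by
  obtain ⟨q, hq, rfl⟩ := extend_eq_true.1 h
  exact hq

/-- The union of a point of `K[T × M]` and a point of `K[S × N]` belongs to `K[T × M]`. -/
def Joinable (x : PairSpace T M) (z : PairSpace S N) : Prop :=
  IsSmall fun p => x.1 p || extend z p

open Classical in
/-- The union of a point of `K[T × M]` and a point of `K[S × N]`, if it belongs to `K[T × M]`. -/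
def join (x : PairSpace T M) (z : PairSpace S N) : PairSpace T M :=
  if h : Joinable x z then ⟨_, h⟩ else x

theorem join_apply {x : PairSpace T M} {z : PairSpace S N} (h : Joinable x z) (p : T × M) :
    (join x z).1 p = (x.1 p || extend z p) := by
  simp [join, h]

theorem gMap_eq_zero_iff {x : PairSpace T M} :
    gMap S N x = zero S N ↔ ∀ q : S × N, x.1 (q.1, q.2) = false :=
  ⟨fun h q => congrFun (congrArg Subtype.val h) q, fun h => ext h⟩

theorem gMap_join {x : PairSpace T M} {z : PairSpace S N} (hx : gMap S N x = zero S N)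
    (h : Joinable x z) : gMap S N (join x z) = z := by
  ext q
  change (join x z).1 (q.1, q.2) = z.1 q
  rw [join_apply h, extend_coe, gMap_eq_zero_iff.1 hx q, Bool.false_or]

theorem join_zero (x : PairSpace T M) : join x (zero S N) = x := by
  by_cases h : Joinable x (zero S N)
  · ext p
    rw [join_apply h, Bool.eq_iff_iff, Bool.or_eq_true, extend_eq_true]
    simp
  · simp [join, h]

theorem joinable_restr (A : Set (T × M)) (y : PairSpace T M) :
    Joinable (restr A y) (gMap S N y) :=
  y.2.mono fun p hp => by
    rw [Bool.or_eq_true, restr_apply_eq_true] at hp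
    exact hp.elim And.right extend_gMap

theorem joinable_of_subset {x y : PairSpace T M} (h : x.carrier ⊆ y.carrier) :
    Joinable x (gMap S N y) :=
  y.2.mono fun p hp => by
    rw [Bool.or_eq_true] at hp
    exact hp.elim (fun hp => h hp) extend_gMap

theorem tendsto_join {ι : Type*} {l : Filter ι} {z : ι → PairSpace S N} {z₀ : PairSpace S N}
    (hz : Tendsto z l (𝓝 z₀)) {x : PairSpace T M} (hx : ∀ᶠ i in l, Joinable x (z i))
    (hx₀ : Joinable x z₀) : Tendsto (fun i => join x (z i)) l (𝓝 (join x z₀)) := by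
  refine tendsto_iff.2 fun p => ?_
  by_cases hp : p.1 ∈ S ∧ p.2 ∈ N
  · filter_upwards [hx, tendsto_iff.1 hz (⟨p.1, hp.1⟩, ⟨p.2, hp.2⟩)] with i hi hzi
    rw [join_apply hi, join_apply hx₀]
    simp [extend, hp, hzi]
  · filter_upwards [hx] with i hi
    rw [join_apply hi, join_apply hx₀]
    simp [extend, hp]

/-- Since `x` misses `S × N`, the union is disjoint and cardinalities add; comparability can only
fail between a point of `x` and a point of `z`. -/
theorem joinable_iff {x : PairSpace T M} {z : PairSpace S N} (hx : gMap S N x = zero S N) :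
    Joinable x z ↔ x.carrier.encard + z.carrier.encard ≤ 2 ∧
      ∀ p ∈ x.carrier, ∀ q ∈ z.carrier, (q.1 : T) ≤ p.1 ∨ p.1 ≤ q.1 := by
  let e : S × N → T × M := fun q => (q.1, q.2)
  have he : Function.Injective e := fun a b h => by
    simpa [e, Prod.ext_iff, Subtype.ext_iff] using h
  have hunion : {p | (x.1 p || extend z p) = true} = x.carrier ∪ e '' z.carrier := by
    ext p
    rw [mem_ofPred_eq, Bool.or_eq_true, extend_eq_true]
    rfl
  have hdisj : Disjoint x.carrier (e '' z.carrier) := by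
    rw [Set.disjoint_right]
    rintro _ ⟨q, -, rfl⟩ hq
    have h1 := gMap_eq_zero_iff.1 hx q
    have h2 : x.1 (q.1, q.2) = true := hq
    simp [h1] at h2
  have hz : IsChain (· ≤ ·) (Prod.fst '' (e '' z.carrier)) := by
    rintro _ ⟨_, ⟨p, hp, rfl⟩, rfl⟩ _ ⟨_, ⟨q, hq, rfl⟩, rfl⟩ -
    exact z.isChain_carrier.total ⟨p, hp, rfl⟩ ⟨q, hq, rfl⟩
  rw [Joinable, isSmall_iff, hunion, encard_union_eq hdisj, he.injOn.encard_image]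
  refine and_congr_right fun _ => ⟨fun h p hp q hq => ?_, ?_⟩
  · exact h.total ⟨e q, Or.inr ⟨q, hq, rfl⟩, rfl⟩ ⟨p, Or.inl hp, rfl⟩
  · rintro h _ ⟨p, hp | ⟨p, hp, rfl⟩, rfl⟩ _ ⟨q, hq | ⟨q, hq, rfl⟩, rfl⟩ hne
    · exact x.isChain_carrier ⟨p, hp, rfl⟩ ⟨q, hq, rfl⟩ hne
    · exact (h p hp q hq).symm
    · exact h q hq p hp
    · exact hz ⟨_, ⟨p, hp, rfl⟩, rfl⟩ ⟨_, ⟨q, hq, rfl⟩, rfl⟩ hne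

end PairSpace

open PairSpace

/-- The points of `K[S × N]` that can be added to the points representing `u`. -/
def Compat (S : Set T) (N : Set M) (u : RHat S) (z : PairSpace S N) : Prop :=
  u = ⊥ ∨ (∃ r : R S, u = ((r : WithTop (R S)) : RHat S) ∧ z.carrier.encard ≤ 1 ∧
    ∀ q ∈ z.carrier, (q.1 : T) ∈ OrderDual.ofDual r.1) ∨ z.carrier = ∅

theorem Compat.anti {u u' : RHat S} (h : u ≤ u') {z : PairSpace S N} (hz : Compat S N u' z) :
    Compat S N u z := by
  rcases hz with rfl | ⟨r', rfl, hz1, hz2⟩ | hz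
  · exact Or.inl (le_bot_iff.1 h)
  · induction u using WithBot.recBotCoe with
    | bot => exact Or.inl rfl
    | coe u =>
      induction u using WithTop.recTopCoe with
      | top => simp at h
      | coe r =>
        have hr : r ≤ r' := by simpa using h
        exact Or.inr (Or.inl ⟨r, rfl, hz1, fun q hq => hr (hz2 q hq)⟩)
  · exact Or.inr (Or.inr hz)

/-- What can be added to a point of `g⁻¹(0)` depends on its type alone; this is why `R̂` suffices to
describe the fiber order. -/
theorem Represents.joinable_iff {x : PairSpace T M} {u : RHat S} (h : Represents S N x u)
    {z : PairSpace S N} : Joinable x z ↔ Compat S N u z := by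
  rw [PairSpace.joinable_iff h.1]
  obtain ⟨-, ⟨hx, rfl⟩ | ⟨t, γ, hx, rfl⟩ | ⟨hx, rfl⟩⟩ := h
  · simp [hx, Compat, z.encard_carrier_le]
  · have h1 : (1 : ℕ∞) + z.carrier.encard ≤ 2 ↔ z.carrier.encard ≤ 1 := by
      rw [← one_add_one_eq_two]
      exact ENat.add_le_add_iff_left (by simp)
    have h2 : RHat.mk S t ≠ ⊥ := by simp [RHat.mk]
    rw [hx, encard_singleton, h1]
    constructor
    · rintro ⟨ha, hb⟩
      exact Or.inr (Or.inl ⟨_, rfl, ha, fun q hq => ⟨q.1.2, hb _ rfl q hq⟩⟩)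
    · rintro (h | ⟨r, hr, ha, hb⟩ | h)
      · exact (h2 h).elim
      · simp only [RHat.mk, WithBot.coe_inj, WithTop.coe_inj] at hr
        subst hr
        refine ⟨ha, ?_⟩
        rintro p rfl q hq
        exact (hb q hq).2
      · simp [h]
  · have h1 : (2 : ℕ∞) + z.carrier.encard ≤ 2 ↔ z.carrier = ∅ := by
      rw [← encard_eq_zero]
      conv_lhs => rw [← add_zero (2 : ℕ∞), add_assoc, zero_add]
      rw [ENat.add_le_add_iff_left (by simp), nonpos_iff_eq_zero]
    rw [hx, h1]
    constructor
    · exact fun h => Or.inr (Or.inr h.1)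
    · rintro (h | ⟨r, hr, -⟩ | h)
      · simp at h
      · simp [← WithBot.coe_top, WithBot.coe_inj] at hr
      · simp [h]

theorem Represents.unique {x : PairSpace T M} {u u' : RHat S} (h : Represents S N x u)
    (h' : Represents S N x u') : u = u' := by
  obtain ⟨-, ⟨hx, rfl⟩ | ⟨t, γ, hx, rfl⟩ | ⟨hx, rfl⟩⟩ := h <;>
  obtain ⟨-, ⟨hx', rfl⟩ | ⟨t', γ', hx', rfl⟩ | ⟨hx', rfl⟩⟩ := h' <;>
  simp_all

theorem exists_represents {x : PairSpace T M} (hx : gMap S N x = zero S N) :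
    ∃ u, Represents S N x u := by
  have h2 := x.encard_carrier_le
  rcases h2.lt_or_eq with h | h
  · have h1 : x.carrier.encard ≤ 1 := Order.le_of_lt_succ (by simpa [one_add_one_eq_two] using h)
    rcases encard_le_one_iff_eq.1 h1 with h | ⟨⟨t, γ⟩, h⟩
    · exact ⟨_, hx, Or.inl ⟨h, rfl⟩⟩
    · exact ⟨_, hx, Or.inr (Or.inl ⟨t, γ, h, rfl⟩)⟩
  · exact ⟨_, hx, Or.inr (Or.inr ⟨h, rfl⟩)⟩

open Classical in
/-- The element of `R̂` represented by `x`. -/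
def typ (S : Set T) (N : Set M) (x : PairSpace T M) : RHat S :=
  if h : ∃ u, Represents S N x u then h.choose else ⊥

theorem represents_typ {x : PairSpace T M} (hx : gMap S N x = zero S N) :
    Represents S N x (typ S N x) := by
  have h := exists_represents hx
  rw [typ, dif_pos h]
  exact h.choose_spec

theorem Represents.typ_eq {x : PairSpace T M} {u : RHat S} (h : Represents S N x u) :
    typ S N x = u :=
  (represents_typ h.1).unique h

/-- Sequences in `K[S × N]` converging to `0` separate the points of `R̂`. -/
theorem exists_separating_seq (hN : N.Infinite) (hcomp : ∀ t : T, (trace S t).Nonempty)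
    (hS : S.Nonempty) {u u' : RHat S} (h : ¬ u ≤ u') :
    ∃ (z : ℕ → PairSpace S N) (D : Set (RHat S)),
      Tendsto z atTop (𝓝 (zero S N)) ∧ (∀ v n, Compat S N v (z n) ↔ v ∈ D) ∧ u' ∈ D ∧ u ∉ D := by
  obtain ⟨e⟩ : Nonempty (ℕ ↪ N) := ⟨hN.natEmbedding⟩
  have hev : ∀ a : N, ∀ᶠ n in atTop, e n ≠ a := fun a => by
    have := (e.injective.tendsto_cofinite).eventually
      (eventually_cofinite_ne a)
    rwa [Nat.cofinite_eq_atTop] at this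
  by_cases hu' : u' = ⊥
  · subst hu'
    obtain ⟨s, hs⟩ := hS
    -- A doubleton leaves no room for any further point, so it fits the type `⊥` only. The indices
    -- `2 * n` and `2 * n + 1` give two distinct points that leave every finite set.
    have hc : ∀ n : ℕ, ∃ z : PairSpace S N,
        z.carrier = {(⟨s, hs⟩, e (2 * n)), (⟨s, hs⟩, e (2 * n + 1))} := by
      refine fun n => exists_carrier_eq ?_ ?_
      · exact (encard_insert_le _ _).trans (by rw [encard_singleton, one_add_one_eq_two])
      · rw [image_pair]
        simp
    choose z hz using hc
    refine ⟨z, {⊥}, ?_, ?_, rfl, fun hu => h (hu ▸ le_rfl)⟩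
    · refine tendsto_iff.2 fun p => ?_
      have ht1 : Tendsto (fun n : ℕ => 2 * n) atTop atTop :=
        tendsto_atTop_mono (fun n => (by omega : n ≤ _)) tendsto_id
      have ht2 : Tendsto (fun n : ℕ => 2 * n + 1) atTop atTop :=
        tendsto_atTop_mono (fun n => (by omega : n ≤ _)) tendsto_id
      filter_upwards [ht1.eventually (hev p.2), ht2.eventually (hev p.2)] with n h1 h2
      have : p ∉ (z n).carrier := by
        rw [hz]
        rintro (rfl | rfl)
        exacts [h1 rfl, h2 rfl]
      rw [mem_carrier] at this
      simpa [zero] using this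
    · intro v n
      have h2 : (z n).carrier.encard = 2 := by
        rw [hz]
        refine encard_pair fun h => ?_
        have := e.injective (Prod.ext_iff.1 h).2
        omega
      constructor
      · rintro (hv | ⟨r, -, h1, -⟩ | h0)
        · exact hv
        · rw [h2] at h1
          exact absurd h1 (by decide)
        · simp [h0] at h2
      · exact fun hv => Or.inl hv
  -- The singleton `{(s, e n)}` fits exactly `⊥` and the `r` containing `s`, so it remains to find
  -- `s` in `u'` that is not in `u`.
  · suffices ∃ s : S, (∀ r : R S, u = ((r : WithTop (R S)) : RHat S) →
        (s : T) ∉ OrderDual.ofDual r.1) ∧ (∃ r : R S, u' = ((r : WithTop (R S)) : RHat S) ∧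
        (s : T) ∈ OrderDual.ofDual r.1) by
      obtain ⟨s, hsu, r', hr', hsr'⟩ := this
      have hc : ∀ n : ℕ, ∃ z : PairSpace S N, z.carrier = {(s, e n)} := by
        refine fun n => exists_carrier_eq ?_ ?_ <;> simp
      choose z hz using hc
      refine ⟨z, {v | v = ⊥ ∨ ∃ r : R S, v = ((r : WithTop (R S)) : RHat S) ∧
        (s : T) ∈ OrderDual.ofDual r.1}, ?_, ?_, Or.inr ⟨r', hr', hsr'⟩, ?_⟩
      · refine tendsto_iff.2 fun p => ?_
        filter_upwards [hev p.2] with n h1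
        have : p ∉ (z n).carrier := by
          rw [hz]
          rintro rfl
          exact h1 rfl
        rw [mem_carrier] at this
        simpa [zero] using this
      · intro v n
        simp [Compat, hz]
      · rintro (rfl | ⟨r, hr, hs⟩)
        · exact h bot_le
        · exact hsu r hr hs
    induction u' using WithBot.recBotCoe with
    | bot => exact (hu' rfl).elim
    | coe u' =>
    induction u' using WithTop.recTopCoe with
    | top => exact (h le_top).elim
    | coe r' =>
    induction u using WithBot.recBotCoe with
    | bot => exact (h bot_le).elim
    | coe u =>
    induction u using WithTop.recTopCoe with
    | top =>
      obtain ⟨t, ht⟩ := r'.2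
      -- The type `⊤` accepts no point at all, so any element of the nonempty set `r'` will do.
      obtain ⟨s, hs⟩ := hcomp t
      refine ⟨⟨s, hs.1⟩, fun r hr => ?_, r', rfl, ?_⟩
      · simp at hr
      · rw [← ht]; exact hs
    | coe r =>
      have hr : ¬ (OrderDual.ofDual r'.1 ⊆ OrderDual.ofDual r.1) := fun h' => h (by
        rw [WithBot.coe_le_coe, WithTop.coe_le_coe]; exact h')
      obtain ⟨s, hs, hs'⟩ := not_subset.1 hr
      obtain ⟨t, ht⟩ := r'.2
      have hsS : s ∈ S := by
        rw [← ht] at hs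
        exact hs.1
      refine ⟨⟨s, hsS⟩, fun r₁ h₁ => ?_, r', rfl, hs⟩
      rw [WithBot.coe_inj, WithTop.coe_inj] at h₁
      exact h₁ ▸ hs'

end Combinatorics

end FiberWalk

/-! ### Expectations under discrete distributions -/

namespace PMF

variable {α β : Type*}

/-- The expectation of a real function under a discrete probability distribution. -/
def expect (p : PMF α) (h : α → ℝ) : ℝ := ∑' x, (p x).toReal * h x

theorem summable_toReal (p : PMF α) : Summable fun x => (p x).toReal :=
  ENNReal.summable_toReal p.tsum_coe_ne_top

theorem tsum_toReal (p : PMF α) : ∑' x, (p x).toReal = 1 := by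
  rw [← ENNReal.tsum_toReal_eq p.apply_ne_top, p.tsum_coe, ENNReal.toReal_one]

theorem norm_toReal_mul_le (p : PMF α) {h : α → ℝ} {C : ℝ} (hC : ∀ x, ‖h x‖ ≤ C) (x : α) :
    ‖(p x).toReal * h x‖ ≤ (p x).toReal * C := by
  rw [norm_mul, Real.norm_of_nonneg ENNReal.toReal_nonneg]
  exact mul_le_mul_of_nonneg_left (hC x) ENNReal.toReal_nonneg

theorem norm_expect_le (p : PMF α) {h : α → ℝ} {C : ℝ} (hC : ∀ x, ‖h x‖ ≤ C) :
    ‖p.expect h‖ ≤ C := by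
  refine (tsum_of_norm_bounded (p.summable_toReal.mul_right C).hasSum
    (p.norm_toReal_mul_le hC)).trans ?_
  rw [tsum_mul_right, p.tsum_toReal, one_mul]

theorem expect_pure (a : α) (h : α → ℝ) : (pure a).expect h = h a := by
  rw [expect, tsum_eq_single a]
  · simp
  · intro b hb
    simp [pure_apply_of_ne _ _ hb]

theorem expect_bind (p : PMF α) (k : α → PMF β) {h : β → ℝ} {C : ℝ} (hC : ∀ x, ‖h x‖ ≤ C) :
    (p.bind k).expect h = p.expect fun a => (k a).expect h := by
  have hs : Summable fun z : α × β => (p z.1 * k z.1 z.2).toReal := by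
    refine ENNReal.summable_toReal ?_
    rw [ENNReal.tsum_prod (f := fun a b => p a * k a b)]
    simp [ENNReal.tsum_mul_left, tsum_coe]
  have hs' : Summable (Function.uncurry fun (a : α) (b : β) =>
      (p a * k a b).toReal * h b) := by
    refine .of_norm_bounded (hs.mul_right C) fun z => ?_
    rw [Function.uncurry, norm_mul, Real.norm_of_nonneg ENNReal.toReal_nonneg]
    exact mul_le_mul_of_nonneg_left (hC _) ENNReal.toReal_nonneg
  calc (p.bind k).expect h = ∑' b, ∑' a, (p a * k a b).toReal * h b := by
        refine tsum_congr fun b => ?_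
        rw [bind_apply, ENNReal.tsum_toReal_eq fun a =>
          ENNReal.mul_ne_top (p.apply_ne_top a) ((k a).apply_ne_top b), tsum_mul_right]
    _ = ∑' a, ∑' b, (p a * k a b).toReal * h b := hs'.tsum_comm
    _ = _ := by
        refine tsum_congr fun a => ?_
        change _ = (p a).toReal * ∑' b, (k a b).toReal * h b
        rw [← tsum_mul_left]
        exact tsum_congr fun b => by rw [ENNReal.toReal_mul, mul_assoc]

theorem expect_map (p : PMF α) (φ : α → β) {h : β → ℝ} {C : ℝ} (hC : ∀ x, ‖h x‖ ≤ C) :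
    (p.map φ).expect h = p.expect (h ∘ φ) := by
  rw [map, expect_bind _ _ hC]
  simp [Function.comp_def, expect_pure]

/-- Dominated convergence for sums works along any filter, so it applies to neighbourhood filters
and to the net of finite sets alike. -/
theorem tendsto_expect {ι : Type*} {l : Filter ι} (p : PMF α) {h : ι → α → ℝ} {h₀ : α → ℝ}
    {C : ℝ} (hC : ∀ i x, ‖h i x‖ ≤ C)
    (hh : ∀ x ∈ p.support, Tendsto (fun i => h i x) l (𝓝 (h₀ x))) :
    Tendsto (fun i => p.expect (h i)) l (𝓝 (p.expect h₀)) := by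
  refine tendsto_tsum_of_dominated_convergence (p.summable_toReal.mul_right C) (fun x => ?_)
    (.of_forall fun i => p.norm_toReal_mul_le (hC i))
  by_cases hx : x ∈ p.support
  · exact (hh x hx).const_mul _
  · simp [(p.apply_eq_zero_iff x).2 hx, tendsto_const_nhds]

theorem exists_finset_lt_toOuterMeasure (p : PMF α) {s : Set α} {r : ENNReal}
    (hr : r < p.toOuterMeasure s) :
    ∃ F : Finset α, (F : Set α) ⊆ s ∩ p.support ∧ r < p.toOuterMeasure F := by
  classical
  rw [← toOuterMeasure_apply_inter_support, toOuterMeasure_apply, ENNReal.tsum_eq_iSup_sum,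
    lt_iSup_iff] at hr
  obtain ⟨F, hF⟩ := hr
  refine ⟨{x ∈ F | x ∈ s ∩ p.support}, fun x hx => ?_, hF.trans_le ?_⟩
  · simpa using (Finset.mem_filter.1 hx).2
  · rw [toOuterMeasure_apply_finset, Finset.sum_filter]
    exact (Finset.sum_congr rfl fun x _ => by rw [indicator_apply]).le

theorem toOuterMeasure_add_compl (p : PMF α) (s : Set α) :
    p.toOuterMeasure s + p.toOuterMeasure sᶜ = 1 := by
  rw [toOuterMeasure_apply, toOuterMeasure_apply, ← ENNReal.tsum_add]
  conv_rhs => rw [← p.tsum_coe]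
  exact tsum_congr fun x => congrFun (indicator_self_add_compl s p) x

end PMF

/-! ### Discrete distributions as Radon measures -/

namespace FiberWalk

namespace RadonProb

section Discrete

variable {K : Type*} [TopologicalSpace K] [T2Space K] [MeasurableSpace K] [BorelSpace K]

/-- The Radon probability measure of a discrete distribution. -/
def ofPMF (p : PMF K) : RadonProb K :=
  ⟨⟨p.toMeasure, inferInstance⟩, ⟨fun U hU r hr => by
    change r < p.toMeasure U at hr
    rw [p.toMeasure_apply_eq_toOuterMeasure] at hr
    obtain ⟨F, hF, hr⟩ := p.exists_finset_lt_toOuterMeasure hr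
    refine ⟨F, hF.trans inter_subset_left, F.finite_toSet.isCompact, ?_⟩
    change r < p.toMeasure F
    rwa [p.toMeasure_apply_eq_toOuterMeasure]⟩⟩

theorem ofPMF_apply (p : PMF K) (s : Set K) :
    ((ofPMF p).1 : Measure K) s = p.toOuterMeasure s :=
  p.toMeasure_apply_eq_toOuterMeasure s

theorem ofPMF_injective : Function.Injective (ofPMF : PMF K → RadonProb K) := fun _ _ h =>
  PMF.toMeasure_injective (congrArg (fun μ : RadonProb K => (μ.1 : Measure K)) h)

theorem ofPMF_pure (x : K) : ofPMF (PMF.pure x) = dirac x :=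
  Subtype.ext (Subtype.ext (PMF.toMeasure_pure x))

theorem map_ofPMF {L : Type*} [TopologicalSpace L] [T2Space L] [MeasurableSpace L] [BorelSpace L]
    {g : K → L} (hg : Continuous g) (p : PMF K) : map g hg (ofPMF p) = ofPMF (p.map g) :=
  Subtype.ext (Subtype.ext (PMF.toMeasure_map g p hg.measurable))

theorem integral_ofPMF (p : PMF K) (h : BoundedContinuousFunction K ℝ) :
    ∫ x, h x ∂((ofPMF p).1 : Measure K) = p.expect h :=
  p.integral_eq_tsum h (h.integrable p.toMeasure)

omit [T2Space K] in
theorem tendsto_iff_integral {ι : Type*} {l : Filter ι} {μ : ι → RadonProb K} {μ₀ : RadonProb K} :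
    Tendsto μ l (𝓝 μ₀) ↔ ∀ h : BoundedContinuousFunction K ℝ,
      Tendsto (fun i => ∫ x, h x ∂((μ i).1 : Measure K)) l (𝓝 (∫ x, h x ∂(μ₀.1 : Measure K))) :=
  tendsto_subtype_rng.trans ProbabilityMeasure.tendsto_iff_forall_integral_tendsto

theorem tendsto_ofPMF {ι : Type*} {l : Filter ι} {p : ι → PMF K} {q : PMF K}
    (h : ∀ h : BoundedContinuousFunction K ℝ,
      Tendsto (fun i => (p i).expect h) l (𝓝 (q.expect h))) :
    Tendsto (fun i => ofPMF (p i)) l (𝓝 (ofPMF q)) := by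
  refine tendsto_iff_integral.2 fun φ => ?_
  simpa only [integral_ofPMF] using h φ

omit [T2Space K] in
theorem continuous_measure_isClopen {W : Set K} (hW : IsClopen W) :
    Continuous fun μ : RadonProb K => (μ.1 : Measure K) W := by
  have h : ∀ μ : RadonProb K, (μ.1 : Measure K) W =
      ENNReal.ofReal (∫ x, BoundedContinuousFunction.indicator W hW x ∂(μ.1 : Measure K)) := by
    intro μ
    have : (fun x => BoundedContinuousFunction.indicator W hW x) = W.indicator 1 := rfl
    rw [this, integral_indicator_one hW.1.measurableSet, ofReal_measureReal]
  simp_rw [h]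
  refine ENNReal.continuous_ofReal.comp (continuous_iff_continuousAt.2 fun μ => ?_)
  exact tendsto_iff_integral.1 tendsto_id _

/-- The Feller property: integrating `h` against the new measure is integrating the bounded
continuous function `H` against the old one. -/
theorem continuous_ofPMF_bind (pmf : RadonProb K → PMF K) (hpmf : ∀ μ, ofPMF (pmf μ) = μ)
    (κ : K → PMF K)
    (hκ : ∀ h : BoundedContinuousFunction K ℝ, Continuous fun y => (κ y).expect h) :
    Continuous fun μ => ofPMF ((pmf μ).bind κ) := by
  refine continuous_iff_continuousAt.2 fun μ₀ => tendsto_ofPMF fun h => ?_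
  let H : BoundedContinuousFunction K ℝ := BoundedContinuousFunction.ofNormedAddCommGroup
    (fun y => (κ y).expect h) (hκ h) ‖h‖ fun y => (κ y).norm_expect_le h.norm_coe_le_norm
  have key : ∀ μ, ((pmf μ).bind κ).expect h = ∫ x, H x ∂(μ.1 : Measure K) := by
    intro μ
    conv_rhs => rw [← hpmf μ]
    rw [integral_ofPMF, PMF.expect_bind _ _ h.norm_coe_le_norm]
    rfl
  simp_rw [key]
  exact tendsto_iff_integral.1 tendsto_id H

end Discrete

end RadonProb

/-! ### Radon measures on `K[T × M]` are discrete -/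

section Atomic

theorem measure_eq_tsum_of_finite_compacts {K : Type*} [TopologicalSpace K] [T2Space K]
    [MeasurableSpace K] [BorelSpace K] {μ : Measure K} (hμ : μ.InnerRegular) {U : Set K}
    (hU : MeasurableSet U) (h : ∀ C ⊆ U, IsCompact C → C.Finite) :
    μ U = ∑' x, U.indicator (fun x => μ {x}) x := by
  classical
  have hF : ∀ F : Finset K, ∑ x ∈ F, μ {x} = μ F := fun F => by
    simp
  apply le_antisymm
  · rw [hμ.innerRegular.measure_eq_iSup hU]
    refine iSup₂_le fun C hCU => iSup_le fun hC => ?_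
    obtain ⟨F, rfl⟩ := (h C hCU hC).exists_finset_coe
    rw [← hF]
    refine le_trans (Finset.sum_le_sum fun x hx => ?_) (ENNReal.sum_le_tsum F)
    rw [indicator_of_mem (hCU hx)]
  · rw [ENNReal.tsum_eq_iSup_sum]
    refine iSup_le fun F => ?_
    simp_rw [indicator_apply]
    rw [← Finset.sum_filter, hF]
    exact measure_mono fun x hx => (Finset.mem_filter.1 hx).2

variable {T M : Type*} [PartialOrder T]

open PairSpace

theorem isOpen_setOf_le_encard (k : ℕ∞) :
    IsOpen {x : PairSpace T M | k ≤ x.carrier.encard} := by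
  refine isOpen_iff_mem_nhds.2 fun x hx => ?_
  filter_upwards [(isClopen_setOf_subset_carrier x.finite_carrier).isOpen.mem_nhds
    (Subset.refl x.carrier)] with y hy
  exact le_trans hx (encard_le_encard hy)

theorem measurableSet_setOf_encard_eq (k : ℕ∞) :
    MeasurableSet {x : PairSpace T M | x.carrier.encard = k} := by
  have : {x : PairSpace T M | x.carrier.encard = k} =
      {x | k ≤ x.carrier.encard} \ {x | k + 1 ≤ x.carrier.encard} := by
    ext x
    have hx : x.carrier.encard ≠ ⊤ := x.finite_carrier.encard_lt_top.ne
    change x.carrier.encard = k ↔ k ≤ x.carrier.encard ∧ ¬ (k + 1 ≤ x.carrier.encard)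
    constructor
    · rintro rfl
      exact ⟨le_rfl, fun h => absurd h (not_le.2 ((ENat.lt_add_one_iff hx).2 le_rfl))⟩
    · rintro ⟨h1, h2⟩
      by_contra hne
      exact h2 (Order.add_one_le_of_lt (lt_of_le_of_ne h1 (Ne.symm hne)))
  rw [this]
  exact (isOpen_setOf_le_encard _).measurableSet.diff (isOpen_setOf_le_encard _).measurableSet

/-- The points containing `x` form a neighbourhood of `x` in which `x` is the only one of its
cardinality; finitely many of these cover `C`. -/
theorem finite_of_isCompact_of_encard_eq {C : Set (PairSpace T M)} (hC : IsCompact C) {k : ℕ∞}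
    (hk : ∀ x ∈ C, x.carrier.encard = k) : C.Finite := by
  obtain ⟨t, htC, ht⟩ := hC.elim_nhds_subcover (fun x => {y | x.carrier ⊆ y.carrier})
    fun x _ => (isClopen_setOf_subset_carrier x.finite_carrier).isOpen.mem_nhds
      (Subset.refl x.carrier)
  refine t.finite_toSet.subset fun y hy => ?_
  obtain ⟨x, hx, hxy⟩ := mem_iUnion₂.1 (ht hy)
  have : x = y := ext_carrier (x.finite_carrier.eq_of_subset_of_encard_le hxy
    ((hk y hy).trans (hk x (htC x hx)).symm).le)
  exact this ▸ hx

/-- Cut `U` by cardinality; in each layer compact sets are finite, so inner regularity leaves only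
atoms. -/
theorem measure_eq_tsum {μ : Measure (PairSpace T M)} (hμ : μ.InnerRegular)
    {U : Set (PairSpace T M)} (hU : MeasurableSet U) :
    μ U = ∑' x, U.indicator (fun x => μ {x}) x := by
  classical
  let L : ℕ → Set (PairSpace T M) := fun k => {x | x.carrier.encard = k}
  have hL : ∀ k, MeasurableSet (L k) := fun k => measurableSet_setOf_encard_eq _
  have hdisj : Pairwise (Function.onFun Disjoint fun k => U ∩ L k) := fun i j hij =>
    Set.disjoint_left.2 fun x hi hj => hij (by
      have := (show x.carrier.encard = i from hi.2).symm.trans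
        (show x.carrier.encard = j from hj.2)
      exact_mod_cast this)
  have hU' : U = ⋃ k, U ∩ L k := by
    rw [← inter_iUnion, eq_comm, inter_eq_left]
    intro x _
    obtain ⟨n, hn⟩ := ENat.ne_top_iff_exists.1 x.finite_carrier.encard_lt_top.ne
    exact mem_iUnion.2 ⟨n, hn.symm⟩
  calc μ U = ∑' k, μ (U ∩ L k) := by
        conv_lhs => rw [hU']
        exact measure_iUnion hdisj fun k => hU.inter (hL k)
    _ = ∑' k, ∑' x, (U ∩ L k).indicator (fun x => μ {x}) x :=
        tsum_congr fun k => measure_eq_tsum_of_finite_compacts hμ (hU.inter (hL k))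
          fun C hC hC' => finite_of_isCompact_of_encard_eq hC' fun x hx => (hC hx).2
    _ = ∑' x, ∑' k, (U ∩ L k).indicator (fun x => μ {x}) x := ENNReal.tsum_comm
    _ = _ := by
        refine tsum_congr fun x => ?_
        obtain ⟨n, hn⟩ := ENat.ne_top_iff_exists.1 x.finite_carrier.encard_lt_top.ne
        rw [tsum_eq_single n]
        · have : x ∈ L n := hn.symm
          simp [indicator_apply, this]
        · intro m hm
          refine indicator_of_notMem (fun h => hm ?_) _
          have := (show x.carrier.encard = m from h.2).symm.trans hn.symm
          exact_mod_cast this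

/-- Radon probability measures on `K[T × M]` are discrete. -/
theorem exists_ofPMF_eq (μ : RadonProb (PairSpace T M)) : ∃ p, RadonProb.ofPMF p = μ := by
  have h1 : ∑' x, (μ.1 : Measure (PairSpace T M)) {x} = 1 := by
    have := measure_eq_tsum μ.2 MeasurableSet.univ
    rw [measure_univ] at this
    simpa using this.symm
  refine ⟨⟨fun x => (μ.1 : Measure (PairSpace T M)) {x}, h1 ▸ ENNReal.summable.hasSum⟩,
    Subtype.ext (Subtype.ext (Measure.ext fun U hU => ?_))⟩
  refine (PMF.toMeasure_apply _ hU).trans ?_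
  exact (measure_eq_tsum μ.2 hU).symm

/-- The distribution of a Radon probability measure on `K[T × M]`. -/
def pmf (μ : RadonProb (PairSpace T M)) : PMF (PairSpace T M) := (exists_ofPMF_eq μ).choose

theorem ofPMF_pmf (μ : RadonProb (PairSpace T M)) : RadonProb.ofPMF (pmf μ) = μ :=
  (exists_ofPMF_eq μ).choose_spec

end Atomic

end FiberWalk

/-! ### Degenerate images and disintegration -/

namespace PMF

variable {α β : Type*}

theorem map_eq_pure {p : PMF α} {φ : α → β} {b : β} (h : ∀ x ∈ p.support, φ x = b) :
    p.map φ = pure b := by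
  have hb : (p.map φ).support = {b} := by
    rw [support_map]
    exact Set.Subset.antisymm (image_subset_iff.2 h) (singleton_subset_iff.2
      (p.support_nonempty.imp fun x hx => ⟨hx, h x hx⟩))
  have h1 := ((p.map φ).apply_eq_one_iff b).2 hb
  ext c
  by_cases hc : c = b
  · rw [hc, h1, pure_apply_self]
  · rw [pure_apply_of_ne _ _ hc, apply_eq_zero_iff, hb]
    exact hc

theorem map_eq_self {p : PMF α} {φ : α → α} (h : ∀ x ∈ p.support, φ x = x) : p.map φ = p := by
  ext b
  rw [map_apply, tsum_eq_single b]
  · by_cases hb : b ∈ p.support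
    · rw [h b hb, if_pos rfl]
    · rw [(p.apply_eq_zero_iff b).2 hb, ite_self]
  · intro c hc
    by_cases hc' : c ∈ p.support
    · rw [h c hc', if_neg (Ne.symm hc)]
    · rw [(p.apply_eq_zero_iff c).2 hc', ite_self]

/-- Disintegration of a discrete distribution on a product over its second marginal. -/
theorem exists_kernel (π : PMF (α × β)) (d : β → PMF α) :
    ∃ k : β → PMF α, π.map Prod.fst = (π.map Prod.snd).bind k ∧
      (∀ b ∈ (π.map Prod.snd).support, ∀ a ∈ (k b).support, (a, b) ∈ π.support) ∧
      ∀ b ∉ (π.map Prod.snd).support, k b = d b := by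
  classical
  have hex : ∀ b, b ∈ (π.map Prod.snd).support ↔ ∃ z ∈ {z : α × β | z.2 = b}, z ∈ π.support :=
    fun b => by
      rw [mem_support_map_iff]
      exact exists_congr fun z => and_comm
  let k : β → PMF α := fun b =>
    if h : ∃ z ∈ {z : α × β | z.2 = b}, z ∈ π.support then (π.filter _ h).map Prod.fst else d b
  have hk : ∀ b (h : ∃ z ∈ {z : α × β | z.2 = b}, z ∈ π.support),
      k b = (π.filter _ h).map Prod.fst := fun b h => dif_pos h
  refine ⟨k, ?_, fun b hb a ha => ?_, fun b hb => dif_neg (mt (hex b).2 hb)⟩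
  · have key : ∀ a b, (π.map Prod.snd) b * k b a = π (a, b) := by
      intro a b
      by_cases hb : b ∈ (π.map Prod.snd).support
      · have hmass : ∑' z, {z : α × β | z.2 = b}.indicator π z = (π.map Prod.snd) b := by
          rw [← toOuterMeasure_apply, ← toOuterMeasure_apply_singleton (π.map Prod.snd) b,
            toOuterMeasure_map_apply]
          rfl
        rw [hk b ((hex b).1 hb), map_apply Prod.fst, tsum_eq_single (a, b)]
        · rw [if_pos rfl, filter_apply, hmass, indicator_of_mem (by rfl), mul_comm, mul_assoc,
            ENNReal.inv_mul_cancel hb (apply_ne_top _ _), mul_one]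
        · rintro ⟨a', b'⟩ hne
          by_cases ha : a = a'
          · rw [if_pos ha, filter_apply_eq_zero_of_notMem]
            rintro (rfl : b' = b)
            exact hne (by rw [ha])
          · rw [if_neg ha]
      · rw [(apply_eq_zero_iff _ _).2 hb, zero_mul, eq_comm, apply_eq_zero_iff]
        exact fun h => hb ((hex b).2 ⟨_, rfl, h⟩)
    ext a
    rw [bind_apply, map_apply]
    simp_rw [key]
    rw [ENNReal.tsum_prod (f := fun a' b => if a = a' then π (a', b) else 0),
      tsum_eq_single a]
    · simp
    · intro a' ha'
      simp [Ne.symm ha']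
  · rw [hk b ((hex b).1 hb), mem_support_map_iff] at ha
    obtain ⟨⟨a', b'⟩, hz, rfl⟩ := ha
    obtain ⟨rfl, hz'⟩ := (mem_support_filter_iff _).1 hz
    exact hz'

end PMF

/-! ### The fiber order in terms of discrete distributions -/

namespace FiberWalk

open PairSpace RadonProb

variable {T M : Type*} [PartialOrder T] {S : Set T} {N : Set M}

theorem probMap_ofPMF (p : PMF (PairSpace T M)) :
    probMap S N (ofPMF p) = ofPMF (p.map (gMap S N)) :=
  map_ofPMF (continuous_gMap S N) p

theorem probMap_ofPMF_eq_dirac_iff {p : PMF (PairSpace T M)} :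
    probMap S N (ofPMF p) = dirac (zero S N) ↔ ∀ x ∈ p.support, gMap S N x = zero S N := by
  rw [probMap_ofPMF, ← ofPMF_pure]
  refine ⟨fun h x hx => ?_, fun h => congrArg ofPMF (PMF.map_eq_pure h)⟩
  have h1 : gMap S N x ∈ (p.map (gMap S N)).support := (PMF.mem_support_map_iff _ _ _).2 ⟨x, hx, rfl⟩
  rwa [ofPMF_injective h, PMF.mem_support_pure_iff] at h1

theorem gMap_eq_zero_of_mem_support (ν : FiberZero S N) {p : PMF (PairSpace T M)}
    (hp : ν.1 = ofPMF p) {x : PairSpace T M} (hx : x ∈ p.support) : gMap S N x = zero S N :=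
  probMap_ofPMF_eq_dirac_iff.1 (hp ▸ ν.2) x hx

open Classical in
/-- The kernel that replaces the part of `y` inside `A` according to `k` and keeps `g y`. -/
def relocate (S : Set T) (N : Set M) (k : PairSpace T M → PMF (PairSpace T M)) (A : Set (T × M))
    (y : PairSpace T M) : PMF (PairSpace T M) :=
  if gMap S N (restr A y) = zero S N then
    (k (restr A y)).map fun x => join x (gMap S N y) else PMF.pure y

theorem relocate_of_subset {k : PairSpace T M → PMF (PairSpace T M)} {A : Set (T × M)}
    {y : PairSpace T M} (hy : gMap S N y = zero S N) (hA : y.carrier ⊆ A) :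
    relocate S N k A y = k y := by
  rw [relocate, restr_eq_self hA, if_pos hy, hy]
  exact PMF.map_eq_self fun x _ => join_zero x

section Kernel

variable {k : PairSpace T M → PMF (PairSpace T M)}
  (hk : ∀ x', gMap S N x' = zero S N → ∀ x ∈ (k x').support,
    gMap S N x = zero S N ∧ ∀ z : PairSpace S N, Joinable x' z → Joinable x z)
include hk

theorem map_relocate (A : Set (T × M)) (y : PairSpace T M) :
    (relocate S N k A y).map (gMap S N) = PMF.pure (gMap S N y) := by
  rw [relocate]
  split_ifs with h
  · rw [PMF.map_comp]
    refine PMF.map_eq_pure fun x hx => ?_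
    obtain ⟨h1, h2⟩ := hk _ h x hx
    exact gMap_join h1 (h2 _ (joinable_restr A y))
  · rw [PMF.pure_map]

/-- Near `y₀` the part inside `A` is constant, so the law of `x` is fixed and `y` enters only
through `join x (gMap S N y)`, which is continuous where defined. -/
theorem continuous_expect_relocate {A : Set (T × M)} (hA : A.Finite)
    (h : BoundedContinuousFunction (PairSpace T M) ℝ) :
    Continuous fun y => (relocate S N k A y).expect h := by
  refine continuous_iff_continuousAt.2 fun y₀ => ?_
  have hev := eventually_restr_eq hA y₀
  by_cases h0 : gMap S N (restr A y₀) = zero S N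
  · have heq : (fun y => (k (restr A y₀)).expect fun x => h (join x (gMap S N y))) =ᶠ[𝓝 y₀]
        fun y => (relocate S N k A y).expect h := by
      filter_upwards [hev] with y hy
      rw [relocate, hy, if_pos h0, PMF.expect_map _ _ h.norm_coe_le_norm]
      rfl
    refine ContinuousAt.congr ?_ heq
    refine PMF.tendsto_expect _ (fun _ _ => h.norm_coe_le_norm _) fun x hx => ?_
    obtain ⟨-, h2⟩ := hk _ h0 x hx
    refine (h.continuous.tendsto _).comp (tendsto_join ((continuous_gMap S N).tendsto y₀) ?_
      (h2 _ (joinable_restr A y₀)))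
    filter_upwards [hev] with y hy
    exact h2 _ (hy ▸ joinable_restr A y)
  · have heq : h =ᶠ[𝓝 y₀] fun y => (relocate S N k A y).expect h := by
      filter_upwards [hev] with y hy
      rw [relocate, hy, if_neg h0, PMF.expect_pure]
    exact h.continuous.continuousAt.congr heq

/-- Applying `relocate S N k A` to measures near `ν'` keeps their image under `f`, and for large
finite `A` it sends `ν'` close to `ν`. The preimage of `U` under this map is the required
neighbourhood. -/
theorem le_of_kernel {ν ν' : FiberZero S N} {p' : PMF (PairSpace T M)} (hν' : ν'.1 = ofPMF p')
    (hν : ν.1 = ofPMF (p'.bind k)) : ν ≤ ν' := by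
  intro U hU
  have hlim : Tendsto (fun A : Finset (T × M) => ofPMF (p'.bind (relocate S N k A))) atTop
      (𝓝 (ofPMF (p'.bind k))) := by
    refine tendsto_ofPMF fun h => ?_
    simp_rw [PMF.expect_bind _ _ h.norm_coe_le_norm]
    refine PMF.tendsto_expect _ (fun A y => PMF.norm_expect_le _ h.norm_coe_le_norm)
      fun y hy => ?_
    refine tendsto_const_nhds.congr' ?_
    filter_upwards [eventually_ge_atTop y.finite_carrier.toFinset] with A hA
    rw [relocate_of_subset (gMap_eq_zero_of_mem_support ν' hν' hy)]
    exact fun p hp => hA (y.finite_carrier.mem_toFinset.2 hp)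
  rw [hν] at hU
  -- `U` need not be open, so `A` is chosen with `U` a neighbourhood of the relocated measure, not
  -- merely containing it.
  obtain ⟨A, hA⟩ := (hlim.eventually (eventually_mem_nhds_iff.2 hU)).exists
  let Ψ : RadonProb (PairSpace T M) → RadonProb (PairSpace T M) := fun μ =>
    ofPMF ((pmf μ).bind (relocate S N k A))
  have hΨ : Continuous Ψ := continuous_ofPMF_bind pmf ofPMF_pmf _
    fun h => continuous_expect_relocate hk A.finite_toSet h
  have hpmf : pmf ν'.1 = p' := ofPMF_injective ((ofPMF_pmf _).trans hν')
  refine ⟨Ψ ⁻¹' U, hΨ.continuousAt.preimage_mem_nhds ?_, ?_⟩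
  · simpa only [Ψ, hpmf] using hA
  · rintro _ ⟨μ, hμ, rfl⟩
    refine ⟨Ψ μ, hμ, ?_⟩
    conv_rhs => rw [← ofPMF_pmf μ]
    rw [probMap_ofPMF, probMap_ofPMF, PMF.map_bind]
    simp_rw [map_relocate hk]
    rfl

end Kernel

theorem le_of_coupling {ν ν' : FiberZero S N} (π : PMF (PairSpace T M × PairSpace T M))
    (hν : ν.1 = ofPMF (π.map Prod.fst)) (hν' : ν'.1 = ofPMF (π.map Prod.snd))
    (hπ : ∀ z ∈ π.support, typ S N z.1 ≤ typ S N z.2) : ν ≤ ν' := by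
  -- `le_of_kernel` restricts `k` at every point of `g⁻¹(0)`; off the second marginal's support the
  -- default `PMF.pure` satisfies it trivially.
  obtain ⟨k, hk1, hk2, hk3⟩ := π.exists_kernel PMF.pure
  refine le_of_kernel (k := k) (fun x' hx' x hx => ?_) hν' (hk1 ▸ hν)
  by_cases hb : x' ∈ (π.map Prod.snd).support
  · have hz := hk2 x' hb x hx
    have hx0 : gMap S N x = zero S N := gMap_eq_zero_of_mem_support ν hν
      ((PMF.mem_support_map_iff _ _ _).2 ⟨_, hz, rfl⟩)
    refine ⟨hx0, fun z h => ?_⟩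
    rw [(represents_typ hx').joinable_iff] at h
    exact (represents_typ hx0).joinable_iff.2 (h.anti (hπ _ hz))
  · rw [hk3 x' hb, PMF.mem_support_pure_iff] at hx
    subst hx
    exact ⟨hx', fun _ h => h⟩

/-- Adding `z n` to the points of type in `D` perturbs `ν'` slightly and puts mass `p' D` at `z n`
in the image. A measure near `ν` keeps most of its mass on supersets of points with type outside
`D`, and such supersets never map to `z n`. -/
theorem toOuterMeasure_le_of_le {ν ν' : FiberZero S N} (hle : ν ≤ ν') {p p' : PMF (PairSpace T M)}
    (hp : ν.1 = ofPMF p) (hp' : ν'.1 = ofPMF p') {z : ℕ → PairSpace S N}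
    (hz : Tendsto z atTop (𝓝 (zero S N))) {D : Set (RHat S)}
    (hD : ∀ v n, Compat S N v (z n) ↔ v ∈ D) :
    p'.toOuterMeasure (typ S N ⁻¹' D) ≤ p.toOuterMeasure (typ S N ⁻¹' D) := by
  classical
  by_contra! hlt
  have hjoin : ∀ x : PairSpace T M, gMap S N x = zero S N →
      ∀ n, Joinable x (z n) ↔ typ S N x ∈ D := fun x hx n => by
    rw [(represents_typ hx).joinable_iff, hD]
  set E := typ S N ⁻¹' D with hE
  have h1 : 1 - p'.toOuterMeasure E < p.toOuterMeasure Eᶜ := by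
    have hadd := p.toOuterMeasure_add_compl E
    have hle1 : p'.toOuterMeasure E ≤ 1 := by
      rw [← p'.toOuterMeasure_add_compl E]
      exact le_self_add
    refine ENNReal.sub_lt_of_lt_add hle1 ?_
    rw [← hadd, add_comm]
    exact ENNReal.add_lt_add_left (ne_top_of_le_ne_top ENNReal.one_ne_top
      (hadd ▸ le_add_self)) hlt
  -- A finite `F` makes `W` clopen, so the mass of `W` is a continuous function of the measure.
  obtain ⟨F, hF, hF1⟩ := p.exists_finset_lt_toOuterMeasure h1
  let W : Set (PairSpace T M) := ⋃ x ∈ F, {y | x.carrier ⊆ y.carrier}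
  have hW : IsClopen W := F.finite_toSet.isClopen_biUnion fun x _ =>
    isClopen_setOf_subset_carrier x.finite_carrier
  let V : Set (RadonProb (PairSpace T M)) :=
    {μ | 1 - p'.toOuterMeasure E < (μ.1 : Measure (PairSpace T M)) W}
  have hV : V ∈ 𝓝 ν.1 := by
    refine (isOpen_lt continuous_const (continuous_measure_isClopen hW)).mem_nhds ?_
    change _ < (ν.1.1 : Measure (PairSpace T M)) W
    rw [hp, ofPMF_apply]
    exact hF1.trans_le (measure_mono fun x hx => mem_iUnion₂.2 ⟨x, hx, Subset.refl _⟩)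
  obtain ⟨V', hV', hVV⟩ := hle V hV
  let φ : ℕ → PairSpace T M → PairSpace T M := fun n x => if x ∈ E then join x (z n) else x
  have hlim : Tendsto (fun n => ofPMF (p'.map (φ n))) atTop (𝓝 ν'.1) := by
    rw [hp']
    refine tendsto_ofPMF fun h => ?_
    simp_rw [PMF.expect_map _ _ h.norm_coe_le_norm]
    refine PMF.tendsto_expect _ (fun n x => h.norm_coe_le_norm _) fun x hx => ?_
    refine (h.continuous.tendsto x).comp ?_
    by_cases hxE : x ∈ E
    · have hx0 := gMap_eq_zero_of_mem_support ν' hp' hx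
      simp only [φ, if_pos hxE]
      have := tendsto_join hz (x := x) (.of_forall fun n => (hjoin x hx0 n).2 hxE)
        (hx0 ▸ joinable_of_subset (Subset.refl _))
      rwa [join_zero] at this
    · simp only [φ, if_neg hxE]
      exact tendsto_const_nhds
  obtain ⟨n, hn⟩ := (hlim.eventually hV').exists
  obtain ⟨μ, hμV, hμ⟩ := hVV ⟨_, hn, rfl⟩
  have hmass : p'.toOuterMeasure E ≤ (μ.1 : Measure (PairSpace T M)) (gMap S N ⁻¹' {z n}) := by
    have h2 : ((probMap S N μ).1 : Measure (PairSpace S N)) {z n} =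
        (μ.1 : Measure (PairSpace T M)) (gMap S N ⁻¹' {z n}) :=
      Measure.map_apply (continuous_gMap S N).measurable (measurableSet_singleton _)
    rw [← h2, hμ, probMap_ofPMF, ofPMF_apply, PMF.map_comp, PMF.toOuterMeasure_map_apply]
    refine PMF.toOuterMeasure_mono _ fun x hx => ?_
    have hx0 := gMap_eq_zero_of_mem_support ν' hp' hx.2
    change gMap S N (φ n x) = z n
    simp only [φ, if_pos hx.1]
    exact gMap_join hx0 ((hjoin x hx0 n).2 hx.1)
  have hdisj : Disjoint W (gMap S N ⁻¹' {z n}) := by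
    refine Set.disjoint_left.2 fun y hy hyz => ?_
    obtain ⟨x, hx, hxy⟩ := mem_iUnion₂.1 hy
    have hx0 := gMap_eq_zero_of_mem_support ν hp (hF hx).2
    refine (hF hx).1 ((hjoin x hx0 n).1 ?_)
    rw [← show gMap S N y = z n from hyz]
    exact joinable_of_subset hxy
  have hsum : (μ.1 : Measure (PairSpace T M)) W +
      (μ.1 : Measure (PairSpace T M)) (gMap S N ⁻¹' {z n}) ≤ 1 := by
    rw [← measure_union hdisj ((continuous_gMap S N).measurable (measurableSet_singleton _))]
    exact prob_le_one
  have hfin : p'.toOuterMeasure E ≠ ⊤ := (hmass.trans (le_add_self.trans hsum)).trans_lt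
    ENNReal.one_lt_top |>.ne
  have h3 : (μ.1 : Measure (PairSpace T M)) W ≤ 1 - p'.toOuterMeasure E :=
    ENNReal.le_sub_of_add_le_right hfin ((add_le_add_right hmass _).trans hsum)
  exact absurd hμV (not_lt.2 h3)

end FiberWalk

/-! ### Masses of sets and distributions on two points -/

namespace PMF

variable {α β : Type*}

theorem toOuterMeasure_bind_lt_bind {p : PMF α} {k l : α → PMF β} {D : Set β}
    (h : ∀ x ∈ p.support, (k x).toOuterMeasure D ≤ (l x).toOuterMeasure D) {x : α}
    (hx : x ∈ p.support) (hlt : (k x).toOuterMeasure D < (l x).toOuterMeasure D) :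
    (p.bind k).toOuterMeasure D < (p.bind l).toOuterMeasure D := by
  have hfin : (p.bind k).toOuterMeasure D ≠ ⊤ := ne_top_of_le_ne_top ENNReal.one_ne_top
    ((p.bind k).toOuterMeasure_add_compl D ▸ le_self_add)
  rw [toOuterMeasure_bind_apply] at hfin ⊢
  rw [toOuterMeasure_bind_apply]
  refine ENNReal.tsum_lt_tsum (i := x) hfin (fun a => ?_)
    ((ENNReal.mul_lt_mul_iff_right hx (p.apply_ne_top x)).2 hlt)
  by_cases ha : a ∈ p.support
  · exact mul_le_mul_right (h a ha) _
  · simp [(p.apply_eq_zero_iff a).2 ha]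

theorem toOuterMeasure_le_one (p : PMF α) (D : Set α) : p.toOuterMeasure D ≤ 1 :=
  p.toOuterMeasure_add_compl D ▸ le_self_add

theorem toOuterMeasure_pos_iff {p : PMF α} {D : Set α} :
    0 < p.toOuterMeasure D ↔ ∃ x ∈ p.support, x ∈ D := by
  rw [pos_iff_ne_zero, Ne, toOuterMeasure_apply_eq_zero_iff, Set.not_disjoint_iff]

theorem toOuterMeasure_lt_one_iff {p : PMF α} {D : Set α} :
    p.toOuterMeasure D < 1 ↔ ∃ x ∈ p.support, x ∉ D := by
  rw [(p.toOuterMeasure_le_one D).lt_iff_ne, Ne, toOuterMeasure_apply_eq_one_iff, not_subset]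

theorem apply_add_apply_eq_one {p : PMF α} {a b : α} (hab : a ≠ b) (h : p.support ⊆ {a, b}) :
    p a + p b = 1 := by
  classical
  have := (p.toOuterMeasure_apply_eq_one_iff (s := ({a, b} : Finset α))).2 (by simpa using h)
  rwa [toOuterMeasure_apply_finset, Finset.sum_pair hab] at this

theorem ext_of_support_subset_pair {p q : PMF α} {a b : α} (hab : a ≠ b)
    (hp : p.support ⊆ {a, b}) (hq : q.support ⊆ {a, b}) (h : p b = q b) : p = q := by
  have ha : p a = q a := by
    have := (apply_add_apply_eq_one hab hp).trans (apply_add_apply_eq_one hab hq).symm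
    rwa [h, ENNReal.add_left_inj (q.apply_ne_top b)] at this
  ext c
  by_cases hc : c ∈ ({a, b} : Set α)
  · rcases hc with rfl | rfl
    exacts [ha, h]
  · rw [(p.apply_eq_zero_iff c).2 fun h => hc (hp h), (q.apply_eq_zero_iff c).2 fun h => hc (hq h)]

theorem exists_bind_eq_of_apply_le {p q : PMF α} {a b : α} (hab : a ≠ b)
    (hp : p.support ⊆ {a, b}) (hq : q.support ⊆ {a, b}) (h : p b ≤ q b) :
    ∃ k : α → PMF α, (k b).support ⊆ {a, b} ∧ (∀ c ≠ b, k c = pure c) ∧ q.bind k = p := by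
  classical
  have hr : p b / q b ≤ 1 := ENNReal.div_le_of_le_mul (by rwa [one_mul])
  -- Mass at `b` stays with probability `p b / q b` and moves to `a` otherwise. If `q b = 0` then `p
  -- b = 0`, and the convention `0 / 0 = 0` is harmless.
  let m : PMF α := (ofFintype (fun c : Bool => cond c (p b / q b) (1 - p b / q b))
    (by simp [add_tsub_cancel_of_le hr])).map fun c => cond c b a
  have hm : m.support ⊆ {a, b} := by
    intro c hc
    obtain ⟨c, -, rfl⟩ := (mem_support_map_iff _ _ _).1 hc
    cases c <;> simp
  have hmb : m b = p b / q b := by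
    rw [map_apply, tsum_bool]
    simp [hab.symm]
  refine ⟨Function.update pure b m, by simpa using hm, fun c hc => by simp [hc], ?_⟩
  refine ext_of_support_subset_pair hab (fun c hc => ?_) hp ?_
  · obtain ⟨d, hd, hc⟩ := (mem_support_bind_iff _ _ _).1 hc
    by_cases hdb : d = b
    · subst hdb
      rw [Function.update_self] at hc
      exact hm hc
    · rw [Function.update_of_ne hdb, mem_support_pure_iff] at hc
      exact hc ▸ hq hd
  · rw [bind_apply, tsum_eq_single b]
    · rw [Function.update_self, hmb]
      refine ENNReal.mul_div_cancel' (fun h0 => ?_) fun h0 => (q.apply_ne_top b h0).elim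
      exact le_zero_iff.1 (h0 ▸ h)
    · intro c hc
      rw [Function.update_of_ne hc, pure_apply_of_ne _ _ hc.symm, mul_zero]

end PMF

/-! ### Abstract order theory: point masses, covers and walks -/

namespace FiberWalk

/-- The classes `cls q` of the discrete distributions on the ordered set `H` are ordered so that
moving mass downwards decreases the class, and so that the points of `H` are separated by lower sets
whose mass is antitone. -/
structure IsStochasticOrder {H X : Type*} [PartialOrder H] [PartialOrder X] (cls : PMF H → X) :
    Prop where
  surjective : Function.Surjective cls
  bind_le : ∀ (q : PMF H) (k : H → PMF H), (∀ v ∈ q.support, ∀ w ∈ (k v).support, w ≤ v) →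
    cls (q.bind k) ≤ cls q
  separating : ∀ u u' : H, ¬ u ≤ u' → ∃ D : Set H, IsLowerSet D ∧ u' ∈ D ∧ u ∉ D ∧
    ∀ q q' : PMF H, cls q ≤ cls q' → q'.toOuterMeasure D ≤ q.toOuterMeasure D

namespace IsStochasticOrder

variable {H X : Type*} [PartialOrder H] [PartialOrder X] {cls : PMF H → X}
  (hc : IsStochasticOrder cls)
include hc

theorem pure_le_iff {u : H} {q : PMF H} : cls (PMF.pure u) ≤ cls q ↔ ∀ v ∈ q.support, u ≤ v := by
  constructor
  · intro h v hv
    by_contra hne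
    obtain ⟨D, -, hvD, huD, hD⟩ := hc.separating u v hne
    have h1 := hD _ _ h
    rw [PMF.toOuterMeasure_pure_apply, if_neg huD] at h1
    exact absurd (PMF.toOuterMeasure_pos_iff.2 ⟨v, hv, hvD⟩) (not_lt.2 h1)
  · intro h
    have h1 := hc.bind_le q (fun _ => PMF.pure u) fun v hv w hw => by
      rw [(PMF.mem_support_pure_iff _ _).1 hw]
      exact h v hv
    rwa [PMF.bind_const] at h1

theorem le_pure_iff {u : H} {q : PMF H} : cls q ≤ cls (PMF.pure u) ↔ ∀ v ∈ q.support, v ≤ u := by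
  constructor
  · intro h v hv
    by_contra hne
    obtain ⟨D, -, huD, hvD, hD⟩ := hc.separating v u hne
    have h1 := hD _ _ h
    rw [PMF.toOuterMeasure_pure_apply, if_pos huD] at h1
    exact absurd (PMF.toOuterMeasure_lt_one_iff.2 ⟨v, hv, hvD⟩) (not_lt.2 h1)
  · intro h
    have h1 := hc.bind_le (PMF.pure u) (fun _ => q) fun v hv w hw => by
      rw [(PMF.mem_support_pure_iff _ _).1 hv]
      exact h w hw
    rwa [PMF.bind_const] at h1

theorem pure_le_pure_iff {u v : H} : cls (PMF.pure u) ≤ cls (PMF.pure v) ↔ u ≤ v := by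
  rw [hc.pure_le_iff]
  simp

theorem pure_injective : Function.Injective fun u => cls (PMF.pure u) := fun _ _ h =>
  le_antisymm (hc.pure_le_pure_iff.1 h.le) (hc.pure_le_pure_iff.1 h.ge)

theorem pure_lt_pure_iff {u v : H} : cls (PMF.pure u) < cls (PMF.pure v) ↔ u < v :=
  lt_iff_lt_of_le_iff_le' hc.pure_le_pure_iff hc.pure_le_pure_iff

theorem isLUB_image_iff {C : Set H} {s : H} :
    IsLUB ((fun u => cls (PMF.pure u)) '' C) (cls (PMF.pure s)) ↔ IsLUB C s := by
  constructor
  · refine fun h => ⟨fun c hcC => hc.pure_le_pure_iff.1 (h.1 ⟨c, hcC, rfl⟩), fun b hb => ?_⟩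
    refine hc.pure_le_pure_iff.1 (h.2 ?_)
    rintro _ ⟨c, hcC, rfl⟩
    exact hc.pure_le_pure_iff.2 (hb hcC)
  · refine fun h => ⟨?_, fun x hx => ?_⟩
    · rintro _ ⟨c, hcC, rfl⟩
      exact hc.pure_le_pure_iff.2 (h.1 hcC)
    · obtain ⟨q, rfl⟩ := hc.surjective x
      exact hc.pure_le_iff.2 fun v hv => h.2 fun c hcC => hc.pure_le_iff.1 (hx ⟨c, hcC, rfl⟩) v hv

/-- Each point of the support of the supremum `q` is an upper bound of `C`, hence its point mass
dominates `cls q`. So any two support points lie below each other. -/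
theorem exists_eq_pure_of_isLUB {C : Set H} {x : X}
    (h : IsLUB ((fun u => cls (PMF.pure u)) '' C) x) : ∃ s, x = cls (PMF.pure s) := by
  obtain ⟨q, rfl⟩ := hc.surjective x
  obtain ⟨s, hs⟩ := q.support_nonempty
  have hub : ∀ v ∈ q.support, v ∈ upperBounds C := fun v hv c hcC =>
    hc.pure_le_iff.1 (h.1 ⟨c, hcC, rfl⟩) v hv
  have hle : ∀ v ∈ q.support, cls q ≤ cls (PMF.pure v) := fun v hv => h.2 (by
    rintro _ ⟨c, hcC, rfl⟩
    exact hc.pure_le_pure_iff.2 (hub v hv hcC))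
  exact ⟨s, le_antisymm (hle s hs)
    (hc.pure_le_iff.2 fun v hv => hc.le_pure_iff.1 (hle v hv) s hs)⟩

/-- The distribution with less mass at `s` arises from the other by moving mass from `s` down to
`t`. -/
theorem total_of_support_subset_pair {t s : H} (hts : t < s) {p q : PMF H}
    (hp : p.support ⊆ {t, s}) (hq : q.support ⊆ {t, s}) : cls p ≤ cls q ∨ cls q ≤ cls p := by
  have key : ∀ {p q : PMF H}, p.support ⊆ {t, s} → q.support ⊆ {t, s} → p s ≤ q s →
      cls p ≤ cls q := by
    intro p q hp hq h
    obtain ⟨k, hk1, hk2, rfl⟩ := PMF.exists_bind_eq_of_apply_le hts.ne hp hq h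
    refine hc.bind_le q k fun v hv w hw => ?_
    by_cases hvs : v = s
    · subst hvs
      rcases hk1 hw with rfl | rfl
      exacts [hts.le, le_rfl]
    · rw [hk2 v hvs, PMF.mem_support_pure_iff] at hw
      exact hw.le
  exact (le_total (p s) (q s)).imp (key hp hq) (key hq hp)

theorem isChain_Icc_of_covBy {t s : H} (hts : t ⋖ s) :
    IsChain (· ≤ ·) (Icc (cls (PMF.pure t)) (cls (PMF.pure s))) := by
  have hsupp : ∀ q : PMF H, cls q ∈ Icc (cls (PMF.pure t)) (cls (PMF.pure s)) →
      q.support ⊆ {t, s} := fun q hq v hv =>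
    hts.eq_or_eq (hc.pure_le_iff.1 hq.1 v hv) (hc.le_pure_iff.1 hq.2 v hv)
  rintro x hx y hy -
  obtain ⟨p, rfl⟩ := hc.surjective x
  obtain ⟨q, rfl⟩ := hc.surjective y
  exact hc.total_of_support_subset_pair hts.lt (hsupp p hx) (hsupp q hy)

/-- Every way of moving the mass of `q` downwards but not below `t` stays in the interval, so any
two such moves must be comparable. -/
theorem exists_covBy_of_isChain_Icc {t : H} {q : PMF H} (hlt : cls (PMF.pure t) < cls q)
    (hch : IsChain (· ≤ ·) (Icc (cls (PMF.pure t)) (cls q))) :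
    ∃ s, t ⋖ s ∧ q.support ⊆ {t, s} := by
  classical
  have hge := hc.pure_le_iff.1 hlt.le
  have comp : ∀ k l : H → PMF H, (∀ v ∈ q.support, ∀ w ∈ (k v).support, t ≤ w ∧ w ≤ v) →
      (∀ v ∈ q.support, ∀ w ∈ (l v).support, t ≤ w ∧ w ≤ v) →
      cls (q.bind k) ≤ cls (q.bind l) ∨ cls (q.bind l) ≤ cls (q.bind k) := by
    have hmem : ∀ k : H → PMF H, (∀ v ∈ q.support, ∀ w ∈ (k v).support, t ≤ w ∧ w ≤ v) →
        cls (q.bind k) ∈ Icc (cls (PMF.pure t)) (cls q) := fun k hk =>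
      ⟨hc.pure_le_iff.2 fun w hw => by
        obtain ⟨v, hv, hw⟩ := (PMF.mem_support_bind_iff _ _ _).1 hw
        exact (hk v hv w hw).1, hc.bind_le q k fun v hv w hw => (hk v hv w hw).2⟩
    exact fun k l hk hl => hch.total (hmem k hk) (hmem l hl)
  have hupd : ∀ (u : H) (m : PMF H), (∀ w ∈ m.support, t ≤ w ∧ w ≤ u) →
      ∀ v ∈ q.support, ∀ w ∈ (Function.update PMF.pure u m v).support, t ≤ w ∧ w ≤ v := by
    intro u m hm v hv w hw
    by_cases hvu : v = u
    · subst hvu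
      rw [Function.update_self] at hw
      exact hm w hw
    · rw [Function.update_of_ne hvu, PMF.mem_support_pure_iff] at hw
      subst hw
      exact ⟨hge w hv, le_rfl⟩
  have hcov : ∀ u ∈ q.support, u ≠ t → t ⋖ u := by
    intro u hu hut
    refine ⟨lt_of_le_of_ne (hge u hu) hut.symm, fun v htv hvu => ?_⟩
    have htu := htv.trans hvu
    -- With `t < v < u`, sending the mass at `u` to `v` is incomparable with splitting it evenly
    -- between `t` and `u`: the split charges `t` below `v`, and also `u` above `v`.
    let m := PMF.uniformOfFinset {t, u} (Finset.insert_nonempty t {u})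
    have hmt : t ∈ m.support := by simp [m]
    have hmu : u ∈ m.support := by simp [m]
    rcases comp (Function.update PMF.pure u (PMF.pure v)) (Function.update PMF.pure u m)
      (hupd _ _ fun w hw => by
        rw [(PMF.mem_support_pure_iff _ _).1 hw]; exact ⟨htv.le, hvu.le⟩)
      (hupd _ _ fun w hw => by
        have : w = t ∨ w = u := by simpa [m] using hw
        rcases this with rfl | rfl
        exacts [⟨le_rfl, htu.le⟩, ⟨htu.le, le_rfl⟩]) with h | h
    · obtain ⟨D, hDl, htD, hvD, hD⟩ := hc.separating v t htv.not_ge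
      refine absurd (hD _ _ h) (not_le.2 (PMF.toOuterMeasure_bind_lt_bind (fun x _ => ?_) hu ?_))
      · by_cases hx : x = u
        · subst hx
          simp [PMF.toOuterMeasure_pure_apply, hvD]
        · simp [hx]
      · simp only [Function.update_self, PMF.toOuterMeasure_pure_apply, if_neg hvD]
        exact PMF.toOuterMeasure_pos_iff.2 ⟨t, hmt, htD⟩
    · obtain ⟨D, hDl, hvD, huD, hD⟩ := hc.separating u v hvu.not_ge
      refine absurd (hD _ _ h) (not_le.2 (PMF.toOuterMeasure_bind_lt_bind (fun x _ => ?_) hu ?_))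
      · by_cases hx : x = u
        · subst hx
          simp only [Function.update_self, PMF.toOuterMeasure_pure_apply, if_pos hvD]
          exact PMF.toOuterMeasure_le_one _ _
        · simp [hx]
      · simp only [Function.update_self, PMF.toOuterMeasure_pure_apply, if_pos hvD]
        exact PMF.toOuterMeasure_lt_one_iff.2 ⟨u, hmu, huD⟩
  obtain ⟨u, hu, hut⟩ : ∃ u ∈ q.support, u ≠ t := by
    by_contra! h
    exact hlt.not_ge (hc.le_pure_iff.2 fun v hv => (h v hv).le)
  refine ⟨u, hcov u hu hut, fun w hw => ?_⟩
  by_contra hne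
  obtain ⟨hwt, hwu⟩ : w ≠ t ∧ w ≠ u := by simpa using hne
  have hincomp : ∀ {x y : H}, t ⋖ x → t ⋖ y → x ≠ y → ¬ x ≤ y := fun hx hy hxy hle =>
    hy.2 hx.1 (lt_of_le_of_ne hle hxy)
  -- With two distinct covers of `t` in the support, dropping one to `t` is incomparable with
  -- dropping the other.
  have key : ∀ x ∈ q.support, ∀ y ∈ q.support, t ⋖ x → t ⋖ y → x ≠ y →
      ¬ cls (q.bind (Function.update PMF.pure x (PMF.pure t))) ≤
        cls (q.bind (Function.update PMF.pure y (PMF.pure t))) := by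
    intro x hx y hy htx hty hxy h
    obtain ⟨D, hDl, hxD, hyD, hD⟩ := hc.separating y x (hincomp hty htx hxy.symm)
    have htD : t ∈ D := hDl htx.le hxD
    refine absurd (hD _ _ h) (not_le.2 (PMF.toOuterMeasure_bind_lt_bind (fun z _ => ?_) hy ?_))
    · by_cases hzy : z = y
      · subst hzy
        simp [PMF.toOuterMeasure_pure_apply, htD, hxy.symm, hyD]
      · by_cases hzx : z = x
        · subst hzx
          simp only [Function.update_self, Function.update_of_ne hxy,
            PMF.toOuterMeasure_pure_apply, if_pos htD, if_pos hxD, le_rfl]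
        · simp [hzy, hzx]
    · simp [PMF.toOuterMeasure_pure_apply, htD, hxy.symm, hyD]
  have hpt : ∀ x ∈ q.support, ∀ w ∈ (PMF.pure t).support, t ≤ w ∧ w ≤ x := fun x hx w hw => by
    rw [(PMF.mem_support_pure_iff _ _).1 hw]
    exact ⟨le_rfl, hge x hx⟩
  rcases comp _ _ (hupd u _ (hpt u hu)) (hupd w _ (hpt w hw)) with h | h
  · exact key u hu w hw (hcov u hu hut) (hcov w hw hwt) hwu.symm h
  · exact key w hw u hu (hcov w hw hwt) (hcov u hu hut) hwu h

/-- A chain interval above `t` ends at a distribution on some covering pair `{t, s}`, and among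
these the point mass at `s` is the largest. Distinct covers are incomparable, so it is also maximal
overall. -/
theorem isLinearSucc_iff {t : H} {x : X} :
    IsLinearSucc (cls (PMF.pure t)) x ↔ ∃ s, t ⋖ s ∧ x = cls (PMF.pure s) := by
  constructor
  · rintro ⟨⟨hlt, hch⟩, hmax⟩
    obtain ⟨q, rfl⟩ := hc.surjective x
    obtain ⟨s, hts, hq⟩ := hc.exists_covBy_of_isChain_Icc hlt hch
    have hle : cls q ≤ cls (PMF.pure s) := hc.le_pure_iff.2 fun v hv => by
      rcases hq hv with rfl | rfl
      exacts [hts.le, le_rfl]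
    exact ⟨s, hts, le_antisymm hle
      (hmax ⟨hc.pure_lt_pure_iff.2 hts.lt, hc.isChain_Icc_of_covBy hts⟩ hle)⟩
  · rintro ⟨s, hts, rfl⟩
    refine ⟨⟨hc.pure_lt_pure_iff.2 hts.lt, hc.isChain_Icc_of_covBy hts⟩, ?_⟩
    rintro y ⟨hlt, hch⟩ hle
    obtain ⟨q, rfl⟩ := hc.surjective y
    obtain ⟨u, htu, hq⟩ := hc.exists_covBy_of_isChain_Icc hlt hch
    refine hc.le_pure_iff.2 fun v hv => ?_
    have hsv := hc.pure_le_iff.1 hle v hv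
    rcases hq hv with rfl | rfl
    · exact (hts.lt.not_ge hsv).elim
    · by_contra hvs
      exact htu.2 hts.lt (lt_of_le_not_ge hsv hvs)

/-- By transfinite induction a linear walk never leaves the point masses: successors by
`isLinearSucc_iff`, limits by `exists_eq_pure_of_isLUB`. The conditions then transfer term by term.
-/
theorem isLinearWalk_iff [OrderBot H] {α : Ordinal.{w}} (a : Set.Iio α → X) :
    IsLinearWalk a ↔
      ∃ t : Set.Iio α → H, IsDiscreteWalk t ∧ ∀ β, a β = cls (PMF.pure (t β)) := by
  have hbot : IsBot (cls (PMF.pure ⊥)) := fun x => by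
    obtain ⟨q, rfl⟩ := hc.surjective x
    exact hc.pure_le_iff.2 fun _ _ => bot_le
  constructor
  · rintro ⟨h0, hsucc, hlim⟩
    have hex : ∀ (β : Ordinal.{w}) (hβ : β < α), ∃ s, a ⟨β, hβ⟩ = cls (PMF.pure s) := by
      intro β
      induction β using WellFoundedLT.induction with
      | _ β ih =>
      intro hβ
      rcases Ordinal.zero_or_succ_or_isSuccLimit β with rfl | ⟨γ, rfl⟩ | hl
      · exact ⟨⊥, le_antisymm (h0 hβ _) (hbot _)⟩
      · obtain ⟨t, ht⟩ := ih γ (Order.lt_succ γ) ((Order.le_succ γ).trans_lt hβ)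
        have := hsucc γ hβ
        rw [ht, hc.isLinearSucc_iff] at this
        exact this.imp fun s hs => hs.2
      · have hl' := hlim ⟨β, hβ⟩ hl
        refine hc.exists_eq_pure_of_isLUB (C := {s | ∃ γ : Set.Iio α, γ < ⟨β, hβ⟩ ∧
          a γ = cls (PMF.pure s)}) ?_
        convert hl' using 1
        ext x
        constructor
        · rintro ⟨s, ⟨γ, hγ, h⟩, rfl⟩
          exact ⟨γ, hγ, h⟩
        · rintro ⟨γ, hγ, rfl⟩
          obtain ⟨s, hs⟩ := ih γ.1 hγ γ.2
          exact ⟨s, ⟨γ, hγ, hs⟩, hs.symm⟩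
    choose t ht using fun β : Set.Iio α => hex β.1 β.2
    have ha : a = (fun u => cls (PMF.pure u)) ∘ t := funext ht
    refine ⟨t, ⟨fun h x => ?_, fun β hβ => ?_, fun β hβ => ?_⟩, ht⟩
    · refine hc.pure_le_pure_iff.1 ?_
      rw [← ht]
      exact h0 h _
    · have := hsucc β hβ
      rw [ht ⟨β, (Order.le_succ β).trans_lt hβ⟩, ht ⟨Order.succ β, hβ⟩, hc.isLinearSucc_iff] at this
      obtain ⟨s, hs, h⟩ := this
      rwa [hc.pure_injective h]
    · have := hlim β hβ
      rw [ha, image_comp] at this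
      exact hc.isLUB_image_iff.1 this
  · rintro ⟨t, ⟨h0, hsucc, hlim⟩, ht⟩
    have ha : a = (fun u => cls (PMF.pure u)) ∘ t := funext ht
    refine ⟨fun h x => ?_, fun β hβ => ?_, fun β hβ => ?_⟩
    · rw [ht]
      exact (hc.pure_le_pure_iff.2 (h0 h ⊥)).trans (hbot x)
    · rw [ht, ht]
      exact hc.isLinearSucc_iff.2 ⟨_, hsucc β hβ, rfl⟩
    · rw [ha, image_comp]
      exact hc.isLUB_image_iff.2 (hlim β hβ)

end IsStochasticOrder

end FiberWalk

/-! ### The fiber order as a stochastic order on `R̂` -/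

namespace FiberWalk

open PairSpace RadonProb

section Classes

variable {T M : Type*} [PartialOrder T] {S : Set T} {N : Set M} (h : Realized S N)

/-- A point of `g⁻¹(0)` representing `u`. -/
def rep (u : RHat S) : PairSpace T M := (h u).choose

theorem represents_rep (u : RHat S) : Represents S N (rep h u) u := (h u).choose_spec

theorem typ_rep (u : RHat S) : typ S N (rep h u) = u := (represents_rep h u).typ_eq

/-- The measure in `f⁻¹(δ₀)` obtained by choosing a random element of `R̂`. -/
def fiberOfPMF (q : PMF (RHat S)) : FiberZero S N :=
  ⟨ofPMF (q.map (rep h)), probMap_ofPMF_eq_dirac_iff.2 fun x hx => by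
    obtain ⟨u, -, rfl⟩ := (PMF.mem_support_map_iff _ _ _).1 hx
    exact (represents_rep h u).1⟩

/-- The class of the measures distributed on `R̂` according to `q`. -/
def classOfPMF (q : PMF (RHat S)) : OrderZero S N :=
  toAntisymmetrization (· ≤ ·) (fiberOfPMF h q)

theorem classOfPMF_pure (u : RHat S) : classOfPMF h (PMF.pure u) = unitMass S N h u := by
  refine congrArg (toAntisymmetrization (· ≤ ·)) (Subtype.ext ?_)
  change ofPMF ((PMF.pure u).map (rep h)) = dirac (h u).choose
  rw [PMF.pure_map, ofPMF_pure]
  rfl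

/-- Pair a random `x` with the chosen representative of its type: the types agree, so the coupling
gives both inequalities. -/
theorem toAntisymmetrization_eq_classOfPMF {ν : FiberZero S N} {p : PMF (PairSpace T M)}
    (hp : ν.1 = ofPMF p) :
    toAntisymmetrization (· ≤ ·) ν = classOfPMF h (p.map (typ S N)) := by
  have hfib : (fiberOfPMF h (p.map (typ S N))).1 = ofPMF (p.map (rep h ∘ typ S N)) := by
    rw [← PMF.map_comp]
    rfl
  refine le_antisymm ?_ ?_
  · refine le_of_coupling (p.map fun x => (x, rep h (typ S N x))) ?_ ?_ fun z hz => ?_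
    · rw [PMF.map_comp, hp]
      exact congrArg ofPMF (PMF.map_id p).symm
    · rw [PMF.map_comp, hfib]
      rfl
    · obtain ⟨x, -, rfl⟩ := (PMF.mem_support_map_iff _ _ _).1 hz
      exact (typ_rep h _).ge
  · refine le_of_coupling (p.map fun x => (rep h (typ S N x), x)) ?_ ?_ fun z hz => ?_
    · rw [PMF.map_comp, hfib]
      rfl
    · rw [PMF.map_comp, hp]
      exact congrArg ofPMF (PMF.map_id p).symm
    · obtain ⟨x, -, rfl⟩ := (PMF.mem_support_map_iff _ _ _).1 hz
      exact (typ_rep h _).le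

theorem classOfPMF_surjective : Function.Surjective (classOfPMF h) := fun x => by
  induction x using Quotient.inductionOn with
  | h ν => exact ⟨_, (toAntisymmetrization_eq_classOfPMF h (ofPMF_pmf ν.1).symm).symm⟩

theorem classOfPMF_bind_le (q : PMF (RHat S)) (k : RHat S → PMF (RHat S))
    (hk : ∀ v ∈ q.support, ∀ w ∈ (k v).support, w ≤ v) :
    classOfPMF h (q.bind k) ≤ classOfPMF h q := by
  refine le_of_coupling (q.bind fun v => (k v).map fun w => (rep h w, rep h v)) ?_ ?_
    fun z hz => ?_
  · rw [PMF.map_bind]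
    simp_rw [PMF.map_comp]
    change ofPMF ((q.bind k).map (rep h)) = _
    rw [PMF.map_bind]
    rfl
  · rw [PMF.map_bind]
    simp_rw [PMF.map_comp]
    change ofPMF (q.map (rep h)) = ofPMF (q.bind fun v => (k v).map (Function.const _ (rep h v)))
    simp_rw [PMF.map_const]
    rfl
  · obtain ⟨v, hv, hz⟩ := (PMF.mem_support_bind_iff _ _ _).1 hz
    obtain ⟨w, hw, rfl⟩ := (PMF.mem_support_map_iff _ _ _).1 hz
    simpa only [typ_rep] using hk v hv w hw

theorem isStochasticOrder_classOfPMF (hN : N.Infinite) (hcomp : ∀ t : T, (trace S t).Nonempty)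
    (hS : S.Nonempty) : IsStochasticOrder (classOfPMF h) where
  surjective := classOfPMF_surjective h
  bind_le := classOfPMF_bind_le h
  separating u u' huu' := by
    obtain ⟨z, D, hz, hD, hu', hu⟩ := exists_separating_seq hN hcomp hS huu'
    refine ⟨D, fun a b hba ha => ?_, hu', hu, fun q q' hqq' => ?_⟩
    · exact (hD b 0).1 (((hD a 0).2 ha).anti hba)
    · have hle := toOuterMeasure_le_of_le (ν := fiberOfPMF h q) (ν' := fiberOfPMF h q') hqq' rfl rfl
        hz hD
      have hpre : rep h ⁻¹' (typ S N ⁻¹' D) = D := by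
        ext v
        rw [mem_preimage, mem_preimage, typ_rep]
      rwa [PMF.toOuterMeasure_map_apply, PMF.toOuterMeasure_map_apply, hpre] at hle

theorem toAntisymmetrization_eq_unitMass {u : RHat S} {ν : FiberZero S N}
    (hν : (ν.1.1 : Measure (PairSpace T M)) {x | Represents S N x u} = 1) :
    toAntisymmetrization (· ≤ ·) ν = unitMass S N h u := by
  have hp := (ofPMF_pmf ν.1).symm
  rw [toAntisymmetrization_eq_classOfPMF h hp, ← classOfPMF_pure]
  refine congrArg (classOfPMF h) (PMF.map_eq_pure fun x hx => ?_)
  rw [hp, ofPMF_apply, PMF.toOuterMeasure_apply_eq_one_iff] at hν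
  exact (show Represents S N x u from hν hx).typ_eq

end Classes

end FiberWalk

end

theorem mainTheorem2 {T : Type u} {M : Type v} [PartialOrder T]
    (S : Set T) (N : Set M)
    (hT : FiberWalk.IsTree T) (hS : FiberWalk.IsTree S) (hN : N.Infinite)
    (hcomp : ∀ t : T, (FiberWalk.trace S t).Nonempty)
    (hreal : FiberWalk.Realized S N) :
    -- `a[u]` is the class of every measure in the fiber that is a unit mass at `u`
    (∀ (u : FiberWalk.RHat S) (ν : FiberWalk.FiberZero S N),
      (ν.1.1 : MeasureTheory.Measure (FiberWalk.PairSpace T M))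
          {x | FiberWalk.Represents S N x u} = 1 →
        toAntisymmetrization (· ≤ ·) ν = FiberWalk.unitMass S N hreal u) ∧
    -- linear walks in `𝕆_{δ₀}(f)` are the images of discrete walks in `R̂`
    (∀ (α : Ordinal.{w}) (a : Set.Iio α → FiberWalk.OrderZero S N),
      FiberWalk.IsLinearWalk a ↔
        ∃ t : Set.Iio α → FiberWalk.RHat S, FiberWalk.IsDiscreteWalk t ∧
          ∀ β, a β = FiberWalk.unitMass S N hreal (t β)) ∧
    -- linear successors of `a[t]` correspond to immediate successors of `t`
    (∀ (t : FiberWalk.RHat S) (p : FiberWalk.OrderZero S N),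
      FiberWalk.IsLinearSucc (FiberWalk.unitMass S N hreal t) p ↔
        ∃ s, t ⋖ s ∧ p = FiberWalk.unitMass S N hreal s) ∧
    -- suprema at limit stages are preserved
    (∀ (β : Ordinal.{w}), Order.IsSuccLimit β →
      ∀ t : Set.Iio β → FiberWalk.RHat S, Monotone t → ∀ s : FiberWalk.RHat S,
        IsLUB (Set.range t) s ↔
          IsLUB (Set.range fun γ => FiberWalk.unitMass S N hreal (t γ))
            (FiberWalk.unitMass S N hreal s)) := by
  obtain ⟨⟨r, -⟩, -⟩ := hS
  have hc := FiberWalk.isStochasticOrder_classOfPMF hreal hN hcomp ⟨r.1, r.2⟩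
  have ha := FiberWalk.classOfPMF_pure hreal
  refine ⟨fun u ν hν => FiberWalk.toAntisymmetrization_eq_unitMass hreal hν, fun α a => ?_,
    fun t p => ?_, fun β _ t _ s => ?_⟩
  · simpa only [ha] using hc.isLinearWalk_iff a
  · simpa only [ha] using hc.isLinearSucc_iff (t := t) (x := p)
  · have := hc.isLUB_image_iff (C := Set.range t) (s := s)
    rw [← Set.range_comp] at this
    simpa only [ha, Function.comp_def] using this.symm
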